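/- **Setting.** Let $G$ be a locally compact Hausdorff étale groupoid, with range and source maps $r,s$ and unit space $G^{(0)}$; let $\Gamma$ be a discrete abelian group, $c:G\to\Gamma$ a continuous homomorphism, and $S\subseteq \mathrm{Iso}(c^{-1}(0))=\{g\in G: r(g)=s(g),\ c(g)=0\}$ a subgroupoid which is maximal among the subgroupoids of $\mathrm{Iso}(c^{-1}(0))$ that are abelian (a bundle of abelian groups) and open in $G$. Suppose that $S$ is closed in $G$, normal ($g^{-1}Sg\subseteq S$ for all $g\in G$), and immediately centralizing in $\mathrm{Iso}(c^{-1}(0))$: if $t\in \mathrm{Iso}(c^{-1}(0))$ and $k\ge 1$ are such that for every $a\in S_{r(t)}$ there is $1\le n\le k$ with $ta^n=a^nt$, then $ta=at$ for all $a\in S_{r(t)}$. (Maximality forces $G^{(0)}\subseteq S$.) Let $G/S$ be the quotient groupoid of classes $[g]=gS$, with the quotient topology, and let $\mathfrak s:G/S\to G$ be a continuous section of the quotient map with $\mathfrak s([u])=u$ for $u\in G^{(0)}$. **Constructions.** For a bundle of abelian groups $p:B\to X$, the dual bundle $\widehat B$ consists of the continuous characters $B_x\to\mathbb T$ of the fibres,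 with pointwise multiplication and the topology generated by the sets $\{\chi: p(\chi)\in U\}$ ($U\subseteq X$ open) and $\{\chi:\chi(a)\in V \text{ for all } a\in K\cap B_{p(\chi)}\}$ ($K\subseteq B$ compact, $V\subseteq\mathbb T$ open). Put $T=\widehat S$, a bundle over $G^{(0)}$, and let $G/S$ act on $T$ by $([g].x)(a)=x(g^{-1}ag)$. Let $H=G/S\rtimes \widehat S=\{([g],x): p(x)=s(g)\}$ be the action groupoid, with the fibre-product topology, $r([g],x)=[g].x$, $s([g],x)=x$ (where $x\in T$ is identified with the unit $([p(x)],x)$), $([g],[h].x)([h],x)=([gh],x)$ and $([g],x)^{-1}=([g^{-1}],[g].x)$. The bundle $T$ acts on $H$ by $([g],x)\cdot t=([g],xt)$. Let $H/T$ be the orbit space with the quotient topology and the operations induced from $H$; it acts on $\widehat T$ by $([([g],x)]\diamond\chi)(t)=\chi(\mathrm{Ad}_g t)$, where $\mathrm{Ad}_g(t)(a)=t(gag^{-1})$. The evaluation map $S\to\widehat T$, $a\mapsto(t\mapsto t(a))$, and the map $H/T\to G/S$, $[([g],x)]\mapsto [g]$, will be used to write $S$ for $\widehat T$ and $G/S$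 for $H/T$. For composable $[g],[h]$ put $$\theta([g],[h])=\mathfrak s([gh])^{-1}\mathfrak s([g])\mathfrak s([h])\in S=\widehat T .$$ Let $H/T\boxtimes_\theta\widehat T=\{([g],\chi)\in H/T\times\widehat T: s([g])=p(\chi)\}$, with the relative product topology; $([g],\chi)$ and $([h],\nu)$ are composable iff $s([g])=r([h])$, and $$([g],\chi)([h],\nu)=([g][h],\ \theta([g],[h])\,([h]^{-1}\diamond\chi)\,\nu),\qquad ([g],\chi)^{-1}=([g]^{-1},\ \theta([g],[g]^{-1})^{-1}([g]\diamond\chi^{-1})).$$ **Theorem.** $H$ and $H/T$ are topological groupoids, and $H\to H/T$ is a groupoid homomorphism; the map $H/T\to G/S$ above is an isomorphism of topological groupoids, and the evaluation map $S\to\widehat T$ is an isomorphism of group bundles and a homeomorphism. The map $\theta$ is continuous, satisfies $\theta([r(g)],[g])=1$, and $$([k]^{-1}\diamond\theta([g],[h]))\,\theta([g][h],[k])=\theta([g],[h][k])\,\theta([h],[k])$$ whenever both pairs $([g],[h])$ and $([h],[k])$ are composable; and $H/T\boxtimes_\theta\widehat T$ is a topological groupoid. The map $$\Phi:H/T\boxtimes_\theta\widehat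 T\to G,\qquad \Phi([g],t)=\mathfrak s([g])\,t \qquad (t\in S=\widehat T)$$ is an isomorphism of topological groupoids. Moreover $\overline c([g],x)=c(g)$ defines a continuous homomorphism (cocycle) $\overline c:H\to\Gamma$, and $c\circ\Phi=\overline c$ in the sense that $c(\Phi([\eta],\chi))=\overline c(\eta)$ for all $\eta\in H$ and all $\chi\in\widehat T$ with $([\eta],\chi)\in H/T\boxtimes_\theta\widehat T$. -/

import Mathlib

open Set Topology

universe u v

noncomputable section

/-! ### Groupoids, given by their set of arrows -/

/-- The operations of a groupoid on its set of arrows; units are themselves arrows.  The product is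
a total function whose values on pairs that are not composable carry no meaning and are never used:
`g` and `h` are composable when `s g = r h`. -/
class GroupoidOps (G : Type u) extends Mul G, Inv G where
  r : G → G
  s : G → G

open GroupoidOps

/-- The groupoid axioms. -/
class IsGroupoid (G : Type u) [GroupoidOps G] : Prop where
  r_r : ∀ g : G, r (r g) = r g
  s_r : ∀ g : G, s (r g) = r g
  r_s : ∀ g : G, r (s g) = s g
  s_s : ∀ g : G, s (s g) = s g
  r_mul : ∀ g h : G, s g = r h → r (g * h) = r g
  s_mul : ∀ g h : G, s g = r h → s (g * h) = s h
  assoc : ∀ g h k : G, s g = r h → s h = r k → (g * h) * k = g * (h * k)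
  r_mul_self : ∀ g : G, r g * g = g
  mul_s_self : ∀ g : G, g * s g = g
  r_inv : ∀ g : G, r g⁻¹ = s g
  s_inv : ∀ g : G, s g⁻¹ = r g
  mul_inv_self : ∀ g : G, g * g⁻¹ = r g
  inv_mul_self : ∀ g : G, g⁻¹ * g = s g

/-- A topological groupoid: product (on composable pairs) and inversion are continuous. -/
class IsTopologicalGroupoid (G : Type u) [TopologicalSpace G] [GroupoidOps G] : Prop
    extends IsGroupoid G where
  continuousOn_mul : ContinuousOn (fun p : G × G => p.1 * p.2) {p | s p.1 = r p.2}
  continuous_inv : Continuous (fun g : G => g⁻¹)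

/-- An étale groupoid: the range map, as a map onto the unit space `range r`, is a local
homeomorphism. -/
class IsEtaleGroupoid (G : Type u) [TopologicalSpace G] [GroupoidOps G] : Prop
    extends IsTopologicalGroupoid G where
  isLocalHomeomorph_r : IsLocalHomeomorph (rangeFactorization (r : G → G))

/-- Groupoid homomorphisms. -/
structure IsGroupoidHom {G : Type u} {K : Type v} [GroupoidOps G] [GroupoidOps K] (f : G → K) :
    Prop where
  composable : ∀ g h : G, s g = r h → s (f g) = r (f h)
  map_mul : ∀ g h : G, s g = r h → f (g * h) = f g * f h

/-- Isomorphisms of topological groupoids. -/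
structure IsTopGroupoidIso {G : Type u} {K : Type v} [GroupoidOps G] [GroupoidOps K]
    [TopologicalSpace G] [TopologicalSpace K] (f : G ≃ₜ K) : Prop where
  hom : IsGroupoidHom f
  hom_symm : IsGroupoidHom f.symm

/-- A (continuous) one-cocycle, that is, a continuous homomorphism into an additive group. -/
structure IsCocycle {G : Type u} {Γ : Type v} [GroupoidOps G] [TopologicalSpace G]
    [AddCommGroup Γ] [TopologicalSpace Γ] (c : G → Γ) : Prop where
  continuous : Continuous c
  map_mul : ∀ g h : G, s g = r h → c (g * h) = c g + c h

/-- The unit space of a groupoid. -/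
abbrev Obj (G : Type u) [GroupoidOps G] : Type u := {u : G // r u = u}

/-! ### Bundles of abelian groups and their duals -/

/-- A bundle of abelian groups over `X`. -/
structure AbGroupBundle (X : Type u) [TopologicalSpace X] where
  E : Type u
  top : TopologicalSpace E
  π : E → X
  continuous_π : Continuous π
  grp : ∀ x, CommGroup {e : E // π e = x}

namespace AbGroupBundle

variable {X : Type u} [TopologicalSpace X] (B : AbGroupBundle X)

instance : TopologicalSpace B.E := B.top

/-- The fibre over `x`. -/
abbrev Fib (x : X) : Type u := {e : B.E // B.π e = x}

instance (x : X) : CommGroup (B.Fib x) := B.grp x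

/-- A point of the dual bundle: a base point and a continuous character of the fibre there. -/
@[ext] structure DualE where
  base : X
  char : B.Fib base →ₜ* Circle

/-- The basic sets `{x | x(a) ∈ V for all a ∈ K in the fibre over p(x)}`. -/
def dualNhd (K : Set B.E) (V : Set Circle) : Set B.DualE :=
  {x | ∀ a : B.Fib x.base, a.1 ∈ K → x.char a ∈ V}

/-- The topology of the dual bundle: the fibrewise compact-open topology together with the
preimages of open sets of the base.  For a locally compact Hausdorff `B` a net `xᵢ` converges to
`x` iff `p(xᵢ) → p(x)` and, along every subnet, `xᵢ(aᵢ) → x(a)` whenever `aᵢ → a` with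
`p(aᵢ) = p(xᵢ)`. -/
instance : TopologicalSpace B.DualE :=
  TopologicalSpace.generateFrom
    ({W | ∃ U : Set X, IsOpen U ∧ W = DualE.base ⁻¹' U} ∪
      {W | ∃ (K : Set B.E) (V : Set Circle), IsCompact K ∧ IsOpen V ∧ W = B.dualNhd K V})

theorem continuous_base : Continuous (DualE.base : B.DualE → X) :=
  ⟨fun U hU => TopologicalSpace.isOpen_generateFrom_of_mem (Or.inl ⟨U, hU, rfl⟩)⟩

theorem isOpen_dualNhd {K : Set B.E} {V : Set Circle} (hK : IsCompact K) (hV : IsOpen V) :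
    IsOpen (B.dualNhd K V) :=
  TopologicalSpace.isOpen_generateFrom_of_mem (Or.inr ⟨K, V, hK, hV, rfl⟩)

/-- The fibre of the dual bundle is the dual group of the fibre. -/
def dualFibEquiv (x : X) : {e : B.DualE // e.base = x} ≃ (B.Fib x →ₜ* Circle) where
  toFun e := e.2 ▸ e.1.char
  invFun f := ⟨⟨x, f⟩, rfl⟩
  left_inv := by rintro ⟨⟨y, f⟩, rfl⟩; rfl
  right_inv _ := rfl

/-- The dual bundle, with pointwise multiplication of characters in each fibre. -/
def dual : AbGroupBundle X where
  E := B.DualE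
  top := inferInstance
  π := DualE.base
  continuous_π := B.continuous_base
  grp x := (B.dualFibEquiv x).commGroup

variable {B}

/-- The value of a character over `x` at a point of the fibre over `x`. -/
def pair {x : X} (d : B.dual.Fib x) (a : B.Fib x) : Circle :=
  d.1.char ⟨a.1, a.2.trans d.2.symm⟩

theorem pair_mul_left {x : X} (d d' : B.dual.Fib x) (a : B.Fib x) :
    pair (d * d') a = pair d a * pair d' a := by
  obtain ⟨⟨y, f⟩, rfl⟩ := d
  obtain ⟨⟨z, g⟩, h⟩ := d'
  change z = y at h
  subst h
  rfl

theorem pair_one_left {x : X} (a : B.Fib x) : pair (1 : B.dual.Fib x) a = 1 := rfl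

theorem pair_mul_right {x : X} (d : B.dual.Fib x) (a b : B.Fib x) :
    pair d (a * b) = pair d a * pair d b := by
  obtain ⟨⟨y, f⟩, rfl⟩ := d
  exact map_mul f a b

theorem pair_one_right {x : X} (d : B.dual.Fib x) : pair d (1 : B.Fib x) = 1 := by
  obtain ⟨⟨y, f⟩, rfl⟩ := d
  exact map_one f

theorem dual_fib_ext {x : X} {d d' : B.dual.Fib x} (h : ∀ a, pair d a = pair d' a) : d = d' := by
  obtain ⟨⟨y, f⟩, rfl⟩ := d
  obtain ⟨⟨z, g⟩, hz⟩ := d'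
  change z = y at hz
  subst hz
  have : f = g := ContinuousMonoidHom.ext h
  subst this
  rfl

theorem continuous_pair_left {x : X} (a : B.Fib x) :
    Continuous (fun d : B.dual.Fib x => pair d a) := by
  refine ⟨fun V hV => ?_⟩
  have h : IsOpen (B.dualNhd {a.1} V) := B.isOpen_dualNhd isCompact_singleton hV
  convert h.preimage (continuous_subtype_val : Continuous (Subtype.val : B.dual.Fib x → _)) using 1
  ext d
  obtain ⟨⟨y, f⟩, rfl⟩ := d
  constructor
  · rintro hd ⟨b, hb⟩ hba
    obtain rfl : b = a.1 := hba
    exact hd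
  · intro hd
    exact hd a rfl

/-- The canonical map of `B` into its bidual: `a` is sent to evaluation at `a`. -/
def ev {x : X} (a : B.Fib x) : B.dual.dual.Fib x :=
  ⟨⟨x, { toFun := fun d => pair d a
         map_one' := pair_one_left a
         map_mul' := fun d d' => pair_mul_left d d' a
         continuous_toFun := continuous_pair_left a }⟩, rfl⟩

/-- The canonical map of `B` into its bidual, on total spaces. -/
def evE (a : B.E) : B.dual.dual.E := (ev (⟨a, rfl⟩ : B.Fib (B.π a))).1

theorem continuous_pair_right {x : X} (d : B.dual.Fib x) :
    Continuous (fun a : B.Fib x => pair d a) := by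
  obtain ⟨⟨y, g⟩, rfl⟩ := d
  exact g.continuous_toFun

/-- The composition of a character over `y` with a homomorphism from the fibre over `x` to the
fibre over `y`. -/
def pull {x y : X} (f : B.Fib x →ₜ* B.Fib y) (d : B.dual.Fib y) : B.dual.Fib x :=
  ⟨⟨x, { toFun := fun a => pair d (f a)
         map_one' := by rw [map_one, pair_one_right]
         map_mul' := fun a b => by rw [map_mul, pair_mul_right]
         continuous_toFun := (continuous_pair_right d).comp f.continuous_toFun }⟩, rfl⟩

@[simp] theorem pair_pull {x y : X} (f : B.Fib x →ₜ* B.Fib y) (d : B.dual.Fib y) (a : B.Fib x) :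
    pair (pull f d) a = pair d (f a) := rfl

/-- Composition with a homomorphism between two fibres, as a homomorphism of the dual groups. -/
def transpose [T1Space X] {x y : X} (f : B.Fib x →ₜ* B.Fib y) :
    B.dual.Fib y →ₜ* B.dual.Fib x where
  toFun := pull f
  map_one' := dual_fib_ext fun _ => rfl
  map_mul' d d' := dual_fib_ext fun a => by
    simp only [pair_pull, pair_mul_left]
  continuous_toFun := by
    refine Continuous.subtype_mk (continuous_generateFrom_iff.2 ?_) _
    rintro W (⟨U, hU, rfl⟩ | ⟨K, V, hK, hV, rfl⟩)
    · exact (isOpen_const : IsOpen {_d : B.dual.Fib y | x ∈ U})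
    · have hc : IsCompact (Subtype.val ⁻¹' K : Set (B.Fib x)) := by
        have hcl : IsClosed (B.π ⁻¹' {x}) := isClosed_singleton.preimage B.continuous_π
        exact hcl.isClosedEmbedding_subtypeVal.isCompact_preimage hK
      have hK' := hc.image (continuous_subtype_val.comp f.continuous_toFun)
      convert (B.isOpen_dualNhd hK' hV).preimage
        (continuous_subtype_val : Continuous (Subtype.val : B.dual.Fib y → _)) using 1
      ext d
      obtain ⟨⟨y, g⟩, rfl⟩ := d
      constructor
      · rintro hd ⟨b, hb⟩ ⟨a, ha, rfl⟩
        exact hd a ha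
      · intro hd a ha
        exact hd (f a) ⟨a, ha, rfl⟩

end AbGroupBundle

/-! ### Subgroupoids -/

section Sub

variable {G : Type u} [GroupoidOps G]

/-- Subgroupoids (not necessarily wide). -/
structure IsSubgroupoid (S : Set G) : Prop where
  mul_mem : ∀ a ∈ S, ∀ b ∈ S, s a = r b → a * b ∈ S
  inv_mem : ∀ a ∈ S, a⁻¹ ∈ S

/-- Commutativity of a set of arrows that is contained in the isotropy. -/
def IsCommSet (S : Set G) : Prop := ∀ a ∈ S, ∀ b ∈ S, r a = r b → a * b = b * a

/-- Normality: `g⁻¹ S g ⊆ S` for every arrow `g`. -/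
def IsNormalSet (S : Set G) : Prop :=
  ∀ g : G, ∀ a ∈ S, r a = r g → s a = r g → g⁻¹ * a * g ∈ S

/-- `Iso (c⁻¹(0))`. -/
def isoKer {Γ : Type v} [AddCommGroup Γ] (c : G → Γ) : Set G := {g | r g = s g ∧ c g = 0}

/-- Powers of an arrow of the isotropy. -/
def gpow (g : G) : ℕ → G
  | 0 => r g
  | n + 1 => gpow g n * g

/-- `S` is immediately centralizing in the group bundle `I`. -/
def IsImmediatelyCentralizing (S I : Set G) : Prop :=
  ∀ t ∈ I, ∀ k : ℕ, 1 ≤ k →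
    (∀ a ∈ S, r a = r t → ∃ n, 1 ≤ n ∧ n ≤ k ∧ t * gpow a n = gpow a n * t) →
      ∀ a ∈ S, r a = r t → t * a = a * t

/-- The hypotheses on `(G, S, c)` under which `S` gives a dynamical `Γ`-Cartan subalgebra, for the
trivial 2-cocycle. -/
structure IsDynamicalCartan [TopologicalSpace G] {Γ : Type v} [AddCommGroup Γ] [TopologicalSpace Γ]
    (c : G → Γ) (S : Set G) : Prop where
  cocycle : IsCocycle c
  subset_isoKer : S ⊆ isoKer c
  sub : IsSubgroupoid S
  isOpen : IsOpen S
  comm : IsCommSet S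
  maximal : ∀ S' : Set G, S' ⊆ isoKer c → IsSubgroupoid S' → IsOpen S' → IsCommSet S' →
    S ⊆ S' → S' ⊆ S
  isClosed : IsClosed S
  normal : IsNormalSet S
  immediatelyCentralizing : IsImmediatelyCentralizing S (isoKer c)

variable (G) in
/-- A wide normal subgroupoid that is a bundle of abelian groups. -/
structure NormalAbelianSubgroupoid where
  carrier : Set G
  sub : IsSubgroupoid carrier
  iso : ∀ a ∈ carrier, r a = s a
  comm : IsCommSet carrier
  normal : IsNormalSet carrier
  wide : ∀ u : G, r u = u → u ∈ carrier

end Sub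

section Etale

variable {G : Type u} [GroupoidOps G] [TopologicalSpace G]

open IsGroupoid

theorem isOpen_units [IsEtaleGroupoid G] : IsOpen {u : G | r u = u} := by
  have hr : Continuous (r : G → G) :=
    continuous_subtype_val.comp (IsEtaleGroupoid.isLocalHomeomorph_r (G := G)).continuous
  refine isOpen_iff_forall_mem_open.2 fun x hx => ?_
  obtain ⟨e, hxe, he⟩ := IsEtaleGroupoid.isLocalHomeomorph_r (G := G) x
  refine ⟨e.source ∩ r ⁻¹' e.source, ?_, e.open_source.inter (e.open_source.preimage hr), hxe, ?_⟩
  · rintro g ⟨hg, hg'⟩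
    refine e.injOn hg' hg ?_
    rw [← he]
    exact Subtype.ext (r_r g)
  · change r x ∈ e.source
    rwa [show r x = x from hx]

/-- Maximality forces `S` to contain all units. -/
theorem IsDynamicalCartan.wide [IsEtaleGroupoid G] {Γ : Type v} [AddCommGroup Γ]
    [TopologicalSpace Γ] {c : G → Γ} {S : Set G} (h : IsDynamicalCartan c S) (u : G)
    (hu : r u = u) : u ∈ S := by
  have su : ∀ {u : G}, r u = u → s u = u := fun {u} hu => by rw [← hu, s_r]
  have uu : ∀ {u : G}, r u = u → u * u = u := fun {u} hu => by
    have := r_mul_self u; rwa [hu] at this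
  have uinv : ∀ {u : G}, r u = u → u⁻¹ = u := fun {u} hu => by
    have h1 := mul_inv_self u
    have h2 := r_mul_self u⁻¹
    rw [r_inv, su hu] at h2
    rw [← h2, h1, hu]
  have mulu : ∀ {a u : G}, r u = u → s a = u → a * u = a := fun _ ha => by
    rw [← ha, mul_s_self]
  have umul : ∀ {a u : G}, r u = u → r a = u → u * a = a := fun _ ha => by
    rw [← ha, r_mul_self]
  refine h.maximal (S ∪ {u | r u = u}) ?_ ⟨?_, ?_⟩ (h.isOpen.union isOpen_units) ?_
    subset_union_left (Or.inr hu)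
  · rintro a (ha | ha)
    · exact h.subset_isoKer ha
    · change r a = a at ha
      refine ⟨ha.trans (su ha).symm, ?_⟩
      have := h.cocycle.map_mul a a ((su ha).trans ha.symm)
      rw [uu ha] at this
      simpa using this
  · rintro a (ha | ha) b (hb | hb) hab
    · exact Or.inl (h.sub.mul_mem a ha b hb hab)
    · rw [mulu hb (hab.trans hb)]; exact Or.inl ha
    · rw [umul ha (by rw [← hab, su ha])]; exact Or.inl hb
    · rw [mulu hb (hab.trans hb)]; exact Or.inr ha
  · rintro a (ha | ha)
    · exact Or.inl (h.sub.inv_mem a ha)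
    · rw [uinv ha]; exact Or.inr ha
  · rintro a (ha | ha) b (hb | hb) hab
    · exact h.comm a ha b hb hab
    · have := (h.subset_isoKer ha).1
      rw [mulu hb (by rw [← this, hab, hb]), umul hb (hab.trans hb)]
    · have := (h.subset_isoKer hb).1
      rw [mulu ha (by rw [← this, ← hab, ha]), umul ha (by rw [← hab, ha])]
    · rw [show a = b by rw [← show r a = a from ha, hab, show r b = b from hb]]

/-- The subgroupoid `S` with the closure properties that the constructions below use. -/
def IsDynamicalCartan.toNormal [IsEtaleGroupoid G] {Γ : Type v} [AddCommGroup Γ]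
    [TopologicalSpace Γ] {c : G → Γ} {S : Set G} (h : IsDynamicalCartan c S) :
    NormalAbelianSubgroupoid G where
  carrier := S
  sub := h.sub
  iso _ ha := (h.subset_isoKer ha).1
  comm := h.comm
  normal := h.normal
  wide := h.wide

end Etale

namespace IsGroupoid

variable {G : Type u} [GroupoidOps G] [IsGroupoid G]

theorem inv_inv' (g : G) : g⁻¹⁻¹ = g := by
  have h := mul_s_self g⁻¹⁻¹
  rw [s_inv, r_inv, ← inv_mul_self, ← assoc _ _ _ (by rw [s_inv]) (by rw [s_inv]), inv_mul_self, s_inv,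
    r_mul_self] at h
  exact h.symm

theorem inv_mul_cancel_left' {g h : G} (e : s g = r h) : g⁻¹ * (g * h) = h := by
  rw [← assoc _ _ _ (s_inv g) e, inv_mul_self, e, r_mul_self]

theorem mul_inv_cancel_left' {g h : G} (e : r g = r h) : g * (g⁻¹ * h) = h := by
  rw [← assoc _ _ _ (r_inv g).symm (by rw [s_inv, e]), mul_inv_self, e, r_mul_self]

end IsGroupoid

open IsGroupoid AbGroupBundle

/-- A point of a fibre, viewed in the fibre over an equal base point. -/
def AbGroupBundle.reb {X : Type u} [TopologicalSpace X] {B : AbGroupBundle X} {x y : X}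
    (h : x = y) (a : B.Fib x) : B.Fib y := ⟨a.1, a.2.trans h⟩

namespace NormalAbelianSubgroupoid

/-! ### The group bundle `S` and the quotient groupoid `G/S` -/

section Alg

variable {G : Type u} [GroupoidOps G] [IsGroupoid G] (N : NormalAbelianSubgroupoid G)

/-- `S` acts on the right of `G`; two arrows are equivalent if they are in the same orbit. -/
abbrev setoid : Setoid G where
  r g h := ∃ a ∈ N.carrier, s g = r a ∧ h = g * a
  iseqv :=
    { refl := fun g => ⟨s g, N.wide _ (r_s g), (r_s g).symm, (mul_s_self g).symm⟩
      symm := by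
        rintro g _ ⟨a, ha, e, rfl⟩
        refine ⟨a⁻¹, N.sub.inv_mem a ha, by rw [s_mul _ _ e, r_inv], ?_⟩
        rw [assoc _ _ _ e (r_inv a).symm, mul_inv_self, ← e, mul_s_self]
      trans := by
        rintro g _ _ ⟨a, ha, e, rfl⟩ ⟨b, hb, e', rfl⟩
        rw [s_mul _ _ e] at e'
        exact ⟨a * b, N.sub.mul_mem a ha b hb e', by rw [r_mul _ _ e', e], assoc _ _ _ e e'⟩ }

/-- The quotient `G/S`. -/
def Q : Type u := Quotient N.setoid

/-- The class `[g]` in `G/S`. -/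
def cls (g : G) : N.Q := Quotient.mk N.setoid g

/-- A representative. -/
def rep (q : N.Q) : G := Quotient.out (s := N.setoid) q

theorem cls_rep (q : N.Q) : N.cls (N.rep q) = q := Quotient.out_eq _

/-- The source of a class, in the unit space of `G`. -/
def sX : N.Q → Obj G :=
  Quotient.lift (fun g => ⟨s g, r_s g⟩) (by
    rintro g _ ⟨a, ha, e, rfl⟩
    exact Subtype.ext (e.trans ((N.iso a ha).trans (s_mul _ _ e).symm)))

/-- The range of a class, in the unit space of `G`. -/
def rX : N.Q → Obj G :=
  Quotient.lift (fun g => ⟨r g, r_r g⟩) (by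
    rintro g _ ⟨a, ha, e, rfl⟩
    exact Subtype.ext (r_mul _ _ e).symm)

@[simp] theorem sX_cls (g : G) : (N.sX (N.cls g)).1 = s g := rfl
@[simp] theorem rX_cls (g : G) : (N.rX (N.cls g)).1 = r g := rfl

theorem sX_rep (q : N.Q) : s (N.rep q) = (N.sX q).1 := by rw [← sX_cls, cls_rep]
theorem rX_rep (q : N.Q) : r (N.rep q) = (N.rX q).1 := by rw [← rX_cls, cls_rep]

/-- `[g][h] = [gh]` and `[g]⁻¹ = [g⁻¹]`. -/
instance : GroupoidOps N.Q where
  mul a b := N.cls (N.rep a * N.rep b)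
  inv a := N.cls (N.rep a)⁻¹
  r a := N.cls (N.rX a).1
  s a := N.cls (N.sX a).1

theorem cls_mul {g h : G} (e : s g = r h) : N.cls g * N.cls h = N.cls (g * h) := by
  have hg : N.setoid.r (N.rep (N.cls g)) g := Quotient.exact (N.cls_rep (N.cls g))
  have hh : N.setoid.r (N.rep (N.cls h)) h := Quotient.exact (N.cls_rep (N.cls h))
  change N.cls (N.rep (N.cls g) * N.rep (N.cls h)) = _
  generalize N.rep (N.cls g) = g' at hg
  generalize N.rep (N.cls h) = h' at hh
  obtain ⟨a, ha, ea, rfl⟩ := hg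
  obtain ⟨b, hb, eb, rfl⟩ := hh
  rw [s_mul _ _ ea, r_mul _ _ eb] at e
  have ia := N.iso a ha
  have hc := N.normal h' a ha (ia.trans e) e
  have e1 : s (h'⁻¹ * a) = r h' := by rw [s_mul _ _ (by rw [s_inv, ia, e]), e]
  have rc : r (h'⁻¹ * a * h') = s h' := by
    rw [r_mul _ _ e1, r_mul _ _ (by rw [s_inv, ia, e]), r_inv]
  have sc : s (h'⁻¹ * a * h') = s h' := s_mul _ _ e1
  refine Quotient.sound ⟨h'⁻¹ * a * h' * b, N.sub.mul_mem _ hc b hb (sc.trans eb), ?_, ?_⟩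
  · rw [s_mul _ _ (by rw [ea, ia, e]), r_mul _ _ (sc.trans eb), rc]
  · have e2 : g' * a * (h' * b) = g' * (a * h') * b := by
      rw [← assoc _ _ _ (by rw [s_mul _ _ ea, e]) eb, assoc _ _ _ ea e]
    have e3 : h' * (h'⁻¹ * a * h') = a * h' := by
      rw [assoc _ _ _ (by rw [s_inv, ia, e]) e,
        mul_inv_cancel_left' (by rw [r_mul _ _ e, ia, e])]
    rw [e2, ← e3, ← assoc g' h' _ (by rw [ea, ia, e]) rc.symm]
    rw [assoc _ _ _ (by rw [s_mul _ _ (by rw [ea, ia, e]), rc]) (sc.trans eb)]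

theorem sX_mul {a b : N.Q} (e : N.sX a = N.rX b) : N.sX (a * b) = N.sX b := by
  refine Subtype.ext ?_
  change s (N.rep a * N.rep b) = _
  rw [s_mul _ _ (by rw [sX_rep, rX_rep, e]), sX_rep]

theorem rX_mul {a b : N.Q} (e : N.sX a = N.rX b) : N.rX (a * b) = N.rX a := by
  refine Subtype.ext ?_
  change r (N.rep a * N.rep b) = _
  rw [r_mul _ _ (by rw [sX_rep, rX_rep, e]), rX_rep]

theorem sX_inv (a : N.Q) : N.sX a⁻¹ = N.rX a := by
  refine Subtype.ext ?_
  change s (N.rep a)⁻¹ = _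
  rw [s_inv, rX_rep]

theorem rX_inv (a : N.Q) : N.rX a⁻¹ = N.sX a := by
  refine Subtype.ext ?_
  change r (N.rep a)⁻¹ = _
  rw [r_inv, sX_rep]

theorem sX_unit (u : Obj G) : N.sX (N.cls u.1) = u := by
  refine Subtype.ext ?_
  rw [sX_cls, ← u.2, s_r]

theorem rX_unit (u : Obj G) : N.rX (N.cls u.1) = u := Subtype.ext u.2

/-- A section of `G → G/S` defines `𝔰(ab)⁻¹ 𝔰(a) 𝔰(b)`, which lies in `S`. -/
theorem section_mem {σ : N.Q → G} (hσ : ∀ q, N.cls (σ q) = q) {a b : N.Q} (e : N.sX a = N.rX b) :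
    (σ (a * b))⁻¹ * σ a * σ b ∈ N.carrier ∧ s ((σ (a * b))⁻¹ * σ a * σ b) = (N.sX b).1 := by
  have hs : ∀ q, s (σ q) = (N.sX q).1 := fun q => by rw [← sX_cls, hσ]
  have hr : ∀ q, r (σ q) = (N.rX q).1 := fun q => by rw [← rX_cls, hσ]
  have e' : s (σ a) = r (σ b) := by rw [hs, hr, e]
  have e1 : s (σ (a * b))⁻¹ = r (σ a) := by rw [s_inv, hr, hr, N.rX_mul e]
  refine ⟨?_, by rw [s_mul _ _ (by rw [s_mul _ _ e1, e']), hs]⟩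
  have h : N.cls (σ (a * b)) = N.cls (σ a * σ b) := by rw [← N.cls_mul e', hσ, hσ, hσ]
  obtain ⟨c, hc, ec, h'⟩ := Quotient.exact h
  rw [assoc _ _ _ e1 e', h', inv_mul_cancel_left' ec]
  exact hc

end Alg

variable {G : Type u} [GroupoidOps G] [TopologicalSpace G] [IsTopologicalGroupoid G]
  (N : NormalAbelianSubgroupoid G)

/-- The quotient topology on `G/S`. -/
instance : TopologicalSpace N.Q := inferInstanceAs (TopologicalSpace (Quotient N.setoid))

theorem continuous_r : Continuous (r : G → G) := by
  have h : Continuous (fun g : G => g * g⁻¹) := by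
    refine continuousOn_univ.1 (IsTopologicalGroupoid.continuousOn_mul.comp
      (continuous_id.prodMk IsTopologicalGroupoid.continuous_inv).continuousOn ?_)
    intro g _
    exact (r_inv g).symm
  simpa only [mul_inv_self] using h

/-- `S` as a bundle of abelian groups over the unit space of `G`. -/
def bundle : AbGroupBundle (Obj G) where
  E := {a : G // a ∈ N.carrier}
  top := inferInstance
  π a := ⟨r a.1, r_r a.1⟩
  continuous_π := (continuous_r.comp continuous_subtype_val).subtype_mk _
  grp x :=
    have hr : ∀ a : {e : {a : G // a ∈ N.carrier} // (⟨r e.1, r_r e.1⟩ : Obj G) = x},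
      r a.1.1 = x.1 := fun a => congrArg Subtype.val a.2
    have hs : ∀ a : {e : {a : G // a ∈ N.carrier} // (⟨r e.1, r_r e.1⟩ : Obj G) = x},
      s a.1.1 = x.1 := fun a => by rw [← N.iso _ a.1.2, hr]
    { mul := fun a b => ⟨⟨a.1.1 * b.1.1,
          N.sub.mul_mem _ a.1.2 _ b.1.2 ((hs a).trans (hr b).symm)⟩,
          Subtype.ext ((r_mul _ _ ((hs a).trans (hr b).symm)).trans (hr a))⟩
      one := ⟨⟨x.1, N.wide _ x.2⟩, Subtype.ext x.2⟩
      inv := fun a => ⟨⟨(a.1.1)⁻¹, N.sub.inv_mem _ a.1.2⟩, Subtype.ext ((r_inv _).trans (hs a))⟩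
      mul_assoc := fun a b d => Subtype.ext (Subtype.ext
        (assoc _ _ _ ((hs a).trans (hr b).symm) ((hs b).trans (hr d).symm)))
      one_mul := fun a => Subtype.ext (Subtype.ext (by
        change x.1 * a.1.1 = a.1.1
        rw [← hr a, r_mul_self]))
      mul_one := fun a => Subtype.ext (Subtype.ext (by
        change a.1.1 * x.1 = a.1.1
        rw [← hs a, mul_s_self]))
      inv_mul_cancel := fun a => Subtype.ext (Subtype.ext (by
        change (a.1.1)⁻¹ * a.1.1 = x.1
        rw [inv_mul_self, hs a]))
      mul_comm := fun a b => Subtype.ext (Subtype.ext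
        (N.comm _ a.1.2 _ b.1.2 ((hr a).trans (hr b).symm))) }

/-- `T = Ŝ`. -/
abbrev T : AbGroupBundle (Obj G) := N.bundle.dual

/-- The bidual `T̂`. -/
abbrev That : AbGroupBundle (Obj G) := N.T.dual

/-- Conjugation `a ↦ g a g⁻¹`, from the fibre of `S` at the source to the fibre at the range. -/
def conj (g : G) {x y : Obj G} (hx : x.1 = s g) (hy : y.1 = r g) :
    N.bundle.Fib x →ₜ* N.bundle.Fib y :=
  have hr : ∀ a : N.bundle.Fib x, r a.1.1 = s g := fun a => (congrArg Subtype.val a.2).trans hx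
  have hs : ∀ a : N.bundle.Fib x, s a.1.1 = s g := fun a => by rw [← N.iso _ a.1.2, hr]
  have hg : ∀ a : N.bundle.Fib x, s (g * a.1.1) = r g⁻¹ := fun a => by
    rw [s_mul _ _ (hr a).symm, hs, r_inv]
  { toFun := fun a => ⟨⟨g * a.1.1 * g⁻¹, by
        have := N.normal g⁻¹ a.1.1 a.1.2 (by rw [hr, r_inv]) (by rw [hs, r_inv])
        rwa [inv_inv'] at this⟩,
        Subtype.ext (by
          change r (g * a.1.1 * g⁻¹) = y.1
          rw [r_mul _ _ (hg a), r_mul _ _ (hr a).symm, hy])⟩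
    map_one' := Subtype.ext (Subtype.ext (by
      change g * x.1 * g⁻¹ = y.1
      rw [hx, mul_s_self, mul_inv_self, hy]))
    map_mul' := fun a b => Subtype.ext (Subtype.ext (by
      change g * (a.1.1 * b.1.1) * g⁻¹ = g * a.1.1 * g⁻¹ * (g * b.1.1 * g⁻¹)
      have hab : s a.1.1 = r b.1.1 := by rw [hs, hr]
      have e1 : s (g * a.1.1 * g⁻¹) = r (g * b.1.1) := by
        rw [s_mul _ _ (hg a), s_inv, r_mul _ _ (hr b).symm]
      have e2 : s g⁻¹ = r (g * b.1.1) := by rw [s_inv, r_mul _ _ (hr b).symm]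
      rw [← assoc _ _ _ e1 (hg b), assoc _ _ _ (hg a) e2,
        inv_mul_cancel_left' (hr b).symm, assoc _ _ _ (hr a).symm hab]))
    continuous_toFun := by
      refine Continuous.subtype_mk (Continuous.subtype_mk ?_ _) _
      have hv : Continuous (fun a : N.bundle.Fib x => a.1.1) :=
        continuous_subtype_val.comp continuous_subtype_val
      have h1 : Continuous (fun a : N.bundle.Fib x => g * a.1.1) :=
        continuousOn_univ.1 (IsTopologicalGroupoid.continuousOn_mul.comp
          (continuous_const.prodMk hv).continuousOn (fun a _ => (hr a).symm))
      exact continuousOn_univ.1 (IsTopologicalGroupoid.continuousOn_mul.comp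
          (h1.prodMk continuous_const).continuousOn (fun a _ => hg a)) }

variable [T2Space G]

/-- The action of `G/S` on `Ŝ`: `([g].x)(a) = x(g⁻¹ a g)`. -/
def act (q : N.Q) : N.T.Fib (N.sX q) →ₜ* N.T.Fib (N.rX q) :=
  transpose (N.conj (N.rep q)⁻¹ (by rw [s_inv, rX_rep]) (by rw [r_inv, sX_rep]))

/-- `Ad_g(t)(a) = t(g a g⁻¹)`, for a character `t` over the range of `g`. -/
def ad (q : N.Q) : N.T.Fib (N.rX q) →ₜ* N.T.Fib (N.sX q) :=
  transpose (N.conj (N.rep q) (N.sX_rep q).symm (N.rX_rep q).symm)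

/-! ### The Weyl groupoid `H = G/S ⋊ Ŝ` -/

/-- `H = {([g], x) | p(x) = s(g)}`, with the topology of the fibre product. -/
def H : Type u := {h : N.Q × N.T.E // N.T.π h.2 = N.sX h.1}

instance : TopologicalSpace N.H := instTopologicalSpaceSubtype

variable {N}

/-- The component `x` of `([g], x)`, as a point of the fibre over `s(g)`. -/
def H.pt (h : N.H) : N.T.Fib (N.sX h.1.1) := ⟨h.1.2, h.2⟩

variable (N)

/-- The arrow `([g], x)`. -/
def arrow (q : N.Q) (x : N.T.Fib (N.sX q)) : N.H := ⟨(q, x.1), x.2⟩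

/-- The unit `([p(x)], x)`, which is identified with `x`. -/
def unitOf (x : N.T.E) : N.H := ⟨(N.cls (N.T.π x).1, x), (N.sX_unit _).symm⟩

theorem sX_eq_of_comp {h k : N.H} (e : N.unitOf h.1.2 = N.unitOf (N.act k.1.1 k.pt).1) :
    N.sX h.1.1 = N.rX k.1.1 := by
  have e1 : h.1.2 = (N.act k.1.1 k.pt).1 := congrArg (fun z : N.H => z.1.2) e
  rw [← h.2, e1, (N.act k.1.1 k.pt).2]

open Classical in
/-- `r([g], x) = [g].x`, `s([g], x) = x`, `([g], [h].x)([h], x) = ([gh], x)` and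
`([g], x)⁻¹ = ([g⁻¹], [g].x)`. -/
instance : GroupoidOps N.H where
  r h := N.unitOf (N.act h.1.1 h.pt).1
  s h := N.unitOf h.1.2
  mul h k := if e : N.unitOf h.1.2 = N.unitOf (N.act k.1.1 k.pt).1 then
      N.arrow (h.1.1 * k.1.1) (reb (N.sX_mul (N.sX_eq_of_comp e)).symm k.pt)
    else k
  inv h := N.arrow h.1.1⁻¹ (reb (N.sX_inv _).symm (N.act h.1.1 h.pt))

/-! ### The quotient `H/T` -/

/-- The right action of `T` on `H`: `([g], x) ◂ t = ([g], x t)`. -/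
def ract (h : N.H) (t : N.T.Fib (N.sX h.1.1)) : N.H := N.arrow h.1.1 (h.pt * t)

theorem orbit_iff (h k : N.H) : (∃ t, k = N.ract h t) ↔ h.1.1 = k.1.1 := by
  constructor
  · rintro ⟨t, rfl⟩; rfl
  · obtain ⟨⟨q, x⟩, hx⟩ := h
    obtain ⟨⟨q', y⟩, hy⟩ := k
    rintro (rfl : q = q')
    refine ⟨(⟨x, hx⟩ : N.T.Fib (N.sX q))⁻¹ * ⟨y, hy⟩, ?_⟩
    change _ = N.arrow q ((⟨x, hx⟩ : N.T.Fib (N.sX q)) * _)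
    rw [mul_inv_cancel_left]
    rfl

/-- Two arrows are equivalent if they are in the same orbit of the right action of `T`. -/
abbrev orbitSetoid : Setoid N.H where
  r h k := ∃ t, k = N.ract h t
  iseqv :=
    { refl := fun h => (N.orbit_iff h h).2 rfl
      symm := fun e => (N.orbit_iff _ _).2 ((N.orbit_iff _ _).1 e).symm
      trans := fun e e' =>
        (N.orbit_iff _ _).2 (((N.orbit_iff _ _).1 e).trans ((N.orbit_iff _ _).1 e')) }

/-- The orbit space `H/T`. -/
def HT : Type u := Quotient N.orbitSetoid

/-- The quotient topology on `H/T`. -/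
instance : TopologicalSpace N.HT := inferInstanceAs (TopologicalSpace (Quotient N.orbitSetoid))

/-- The class in `H/T` of an arrow of `H`. -/
def cl (h : N.H) : N.HT := Quotient.mk N.orbitSetoid h

/-- The map `H/T → G/S` that sends the class of `([g], x)` to `[g]`. -/
def toQ : N.HT → N.Q :=
  Quotient.lift (fun h : N.H => h.1.1) (fun h k e => (N.orbit_iff h k).1 e)

open Classical in
/-- `r([h]) = [r(h)]`, `s([h]) = [s(h)]`, `[h]⁻¹ = [h⁻¹]`, and `[h][k]` is the class of `h' k'` for
composable representatives `h'` of `[h]` and `k'` of `[k]`. -/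
instance : GroupoidOps N.HT where
  r := Quotient.map r (fun h k e => (N.orbit_iff _ _).2 (by
    obtain ⟨t, rfl⟩ := e
    change N.cls (N.T.π (N.act _ _).1).1 = N.cls (N.T.π (N.act _ _).1).1
    rw [(N.act _ _).2, (N.act _ _).2]
    rfl))
  s := Quotient.map s (fun h k e => (N.orbit_iff _ _).2 (by
    obtain ⟨t, rfl⟩ := e
    change N.cls (N.T.π h.1.2).1 = N.cls (N.T.π (h.pt * t).1).1
    rw [(h.pt * t).2, h.2]))
  inv := Quotient.map (fun h => h⁻¹) (fun h k e => (N.orbit_iff _ _).2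
    (congrArg (fun q : N.Q => q⁻¹) ((N.orbit_iff h k).1 e)))
  mul a b := if e : ∃ p : N.H × N.H, N.cl p.1 = a ∧ N.cl p.2 = b ∧ s p.1 = r p.2 then
      N.cl (e.choose.1 * e.choose.2)
    else b

theorem comp_toQ {a b : N.HT} (e : s a = r b) : N.sX (N.toQ a) = N.rX (N.toQ b) := by
  induction a using Quotient.inductionOn with | _ h
  induction b using Quotient.inductionOn with | _ k
  have h1 := (N.orbit_iff _ _).1 (Quotient.exact e)
  change N.cls (N.T.π h.1.2).1 = N.cls (N.T.π (N.act k.1.1 k.pt).1).1 at h1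
  rw [(N.act k.1.1 k.pt).2, h.2] at h1
  have h2 := congrArg N.sX h1
  rwa [N.sX_unit, N.sX_unit] at h2

theorem toQ_inv (a : N.HT) : N.toQ a⁻¹ = (N.toQ a)⁻¹ := by
  induction a using Quotient.inductionOn with | _ h
  rfl

theorem toQ_r (a : N.HT) : N.toQ (r a) = N.cls (N.rX (N.toQ a)).1 := by
  induction a using Quotient.inductionOn with | _ h
  change N.cls (N.T.π (N.act h.1.1 h.pt).1).1 = N.cls (N.rX h.1.1).1
  rw [(N.act h.1.1 h.pt).2]

theorem toQ_s (a : N.HT) : N.toQ (s a) = N.cls (N.sX (N.toQ a)).1 := by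
  induction a using Quotient.inductionOn with | _ h
  change N.cls (N.T.π h.1.2).1 = N.cls (N.sX h.1.1).1
  rw [h.2]

theorem toQ_injective {a b : N.HT} (e : N.toQ a = N.toQ b) : a = b := by
  induction a using Quotient.inductionOn with | _ h
  induction b using Quotient.inductionOn with | _ k
  exact Quotient.sound ((N.orbit_iff h k).2 e)

theorem s_eq_r_inv (a : N.HT) : s a = r a⁻¹ :=
  N.toQ_injective (by rw [toQ_s, toQ_r, toQ_inv, rX_inv])

open Classical in
theorem sX_toQ_mul (a b : N.HT) : N.sX (N.toQ (a * b)) = N.sX (N.toQ b) := by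
  have hH : ∀ h k : N.H, N.sX (h * k).1.1 = N.sX k.1.1 := fun h k => by
    rw [← (h * k).2, ← k.2]
    change N.T.π (dite _ _ _ : N.H).1.2 = _
    split_ifs <;> rfl
  change N.sX (N.toQ (dite _ _ _)) = _
  split_ifs with e
  · exact (hH _ _).trans (congrArg (fun d => N.sX (N.toQ d)) e.choose_spec.2.1)
  · rfl

/-! ### The groupoid `H/T ⊠_θ T̂` -/

/-- The action of `H/T` on `T̂`: `[h] ⋄ χ = χ ∘ ρ_h`, where `ρ_h = Ad_g` for `h = ([g], x)`. -/
def dia (a : N.HT) : N.That.Fib (N.sX (N.toQ a)) →ₜ* N.That.Fib (N.rX (N.toQ a)) :=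
  transpose (N.ad (N.toQ a))

/-- `[b]⁻¹ ⋄ χ`. -/
def diaInv (b : N.HT) (χ : N.That.Fib (N.rX (N.toQ b))) : N.That.Fib (N.sX (N.toQ b)) :=
  reb (by rw [toQ_inv, rX_inv]) (N.dia b⁻¹ (reb (by rw [toQ_inv, sX_inv]) χ))

/-- Maps `θ` that assign to each composable pair `(a, b)` of `H/T` a point of `T̂` over the source
of `b`. -/
def Twist : Type u := ∀ a b : N.HT, s a = r b → N.That.Fib (N.sX (N.toQ b))

/-- `θ` is continuous, normalized, and satisfies the cocycle identity
`([c]⁻¹ ⋄ θ([a],[b])) θ([a][b],[c]) = θ([a],[b][c]) θ([b],[c])`. -/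
structure IsTwistingCocycle (θ : N.Twist) : Prop where
  continuous : Continuous
    (fun p : {p : N.HT × N.HT // s p.1 = r p.2} => (θ p.1.1 p.1.2 p.2).1)
  normalized : ∀ (a : N.HT) (e : s (r a) = r a), θ (r a) a e = 1
  cocycle : ∀ (a b c : N.HT) (hab : s a = r b) (hbc : s b = r c) (h1 : s (a * b) = r c)
    (h2 : s a = r (b * c)),
    N.diaInv c (reb (N.comp_toQ hbc) (θ a b hab)) * θ (a * b) c h1 =
      reb (N.sX_toQ_mul b c) (θ a (b * c) h2) * θ b c hbc

variable {N}

/-- `H/T ⊠_θ T̂ = {(a, χ) | s(a) = p(χ)}`, with the restriction of the product topology. -/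
def Box (_θ : N.Twist) : Type u := {z : N.HT × N.That.E // N.That.π z.2 = N.sX (N.toQ z.1)}

instance (θ : N.Twist) : TopologicalSpace (Box θ) := instTopologicalSpaceSubtype

/-- The element `(a, χ)`. -/
def box (θ : N.Twist) (a : N.HT) (χ : N.That.Fib (N.sX (N.toQ a))) : Box θ := ⟨(a, χ.1), χ.2⟩

/-- The component `χ` of `(a, χ)`. -/
def Box.pt {θ : N.Twist} (z : Box θ) : N.That.Fib (N.sX (N.toQ z.1.1)) := ⟨z.1.2, z.2⟩

open Classical in
/-- `(a, χ)(b, ν) = (ab, θ(a, b)(b⁻¹ ⋄ χ)ν)`, `(a, χ)⁻¹ = (a⁻¹, θ(a, a⁻¹)⁻¹ (a ⋄ χ⁻¹))`,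
`r(a, χ) = (r(a), 1)` and `s(a, χ) = (s(a), 1)`. -/
instance (θ : N.Twist) : GroupoidOps (Box θ) where
  r z := box θ (r z.1.1) 1
  s z := box θ (s z.1.1) 1
  mul z w := if e : s z.1.1 = r w.1.1 then
      box θ (z.1.1 * w.1.1) (reb (N.sX_toQ_mul _ _).symm
        (θ z.1.1 w.1.1 e * N.diaInv w.1.1 (reb (N.comp_toQ e) z.pt) * w.pt))
    else w
  inv z := box θ z.1.1⁻¹ ((θ z.1.1 z.1.1⁻¹ (N.s_eq_r_inv _))⁻¹ *
    reb (by rw [toQ_inv, sX_inv]) (N.dia z.1.1 z.pt⁻¹))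

variable (N)

/-! ### The twist given by a section -/

/-- A continuous section `𝔰` of `G → G/S` with `𝔰([u]) = u` for units `u`. -/
structure IsUnitalSection (σ : N.Q → G) : Prop where
  continuous : Continuous σ
  cls_apply : ∀ q, N.cls (σ q) = q
  unital : ∀ u : G, r u = u → σ (N.cls u) = u

variable {N}

/-- `𝔰([gh])⁻¹ 𝔰([g]) 𝔰([h])`, as a point of `S` over the source of `h`. -/
def sectionDefect {σ : N.Q → G} (hσ : N.IsUnitalSection σ) (a b : N.Q) (e : N.sX a = N.rX b) :
    N.bundle.Fib (N.sX b) :=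
  ⟨⟨(σ (a * b))⁻¹ * σ a * σ b, (N.section_mem hσ.cls_apply e).1⟩,
    Subtype.ext ((N.iso _ (N.section_mem hσ.cls_apply e).1).trans
      (N.section_mem hσ.cls_apply e).2)⟩

/-- `θ([g], [h]) = 𝔰([gh])⁻¹ 𝔰([g]) 𝔰([h])`, as a point of `T̂` by means of the canonical map of `S`
into its bidual `T̂`. -/
def theta {σ : N.Q → G} (hσ : N.IsUnitalSection σ) : N.Twist :=
  fun a b e => ev (sectionDefect hσ (N.toQ a) (N.toQ b) (N.comp_toQ e))

end NormalAbelianSubgroupoid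

end

/-!
The groupoid `G` is an extension of `G/S` by the bundle `S` of abelian groups, and a continuous
unital section `𝔰` of `G → G/S` trivializes this extension as a space: `g ↦ ([g], 𝔰([g])⁻¹ g)` is a
homeomorphism of `G` onto the pairs of a class and a point of `S` over its source.  Under this
homeomorphism the product of `G` becomes the product twisted by `θ`.  What has to be shown is that
`S` and `G/S` can be recovered from the dual side, from `H = G/S ⋊ Ŝ` and `T = Ŝ`.

Topologically everything rests on a criterion for the dual bundle: over a Hausdorff base, a map into
it is continuous when its base map and its evaluations are (`continuous_dualE_of_continuousOn`), and
the evaluation of a locally compact bundle is continuous (`continuousOn_pairE`).  With representatives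
chosen by `𝔰`, this makes the action of `G/S` on `Ŝ`, and with it the operations of `H`, continuous
(`continuous_tgt`).

The identification of `S` with its bidual is Pontryagin duality for étale bundles
(`isHomeomorph_evE`).  The fibres are discrete, so bijectivity is the duality of discrete and compact
groups: a group of characters of a compact group that separates points contains every character, by
the Stone–Weierstrass theorem and the orthogonality of characters (`mem_of_separates_points`).  The
dual of an étale bundle is proper over the base (`isCompact_preimage_base`).  Hence a point `χ` of the
bidual close to the evaluation at `a` is uniformly close, on the fibre of the dual over the base point
of `χ`, to the evaluation at the nearby point of a local section through `a`; since the circle has no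
small subgroups, the two are equal, and the evaluation map is open.

The orbit space `H/T` maps bijectively to `G/S`, with a continuous inverse given by the unit section
of `T` (`homeomorphQ`).  The groupoid axioms for `H/T` and for the twisted product are pulled back
along `H/T → G/S` and along `Φ` (`IsTopologicalGroupoid.of_homeomorph`), so that associativity of the
twisted product is not a separate calculation.  The cocycle `c` vanishes on `S` and therefore descends
to `G/S`.
-/

/-! ### Pontryagin duality for discrete abelian groups -/

/-- Characters of a discrete abelian group separate its points: the dual with values in `ℚ/ℤ`
separates them, and `ℚ/ℤ` embeds into the circle. -/
theorem exists_monoidHom_circle_apply_ne_one {A : Type*} [CommGroup A] {a : A} (ha : a ≠ 1) :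
    ∃ f : A →* Circle, f a ≠ 1 := by
  obtain ⟨φ, hφ⟩ := CharacterModule.exists_character_apply_ne_zero_of_ne_zero
    (a := Additive.ofMul a) (by simpa using ha)
  let ι : ℚ →+ Additive Circle :=
    { toFun := fun q => Additive.ofMul (Circle.exp (2 * Real.pi * q))
      map_zero' := by simp
      map_add' := fun p q => by
        rw [← ofMul_mul, ← Circle.exp_add]; push_cast; rw [mul_add] }
  have hι : ∀ q : ℚ, ι q = 0 → q ∈ AddSubgroup.zmultiples (1 : ℚ) := by
    intro q hq
    obtain ⟨n, hn⟩ := Circle.exp_eq_one.1 (show Circle.exp (2 * Real.pi * q) = 1 from hq)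
    refine ⟨n, ?_⟩
    have h2 : (q : ℝ) = n := by
      have := Real.pi_pos
      have h3 : (2 * Real.pi) * (q : ℝ) = (2 * Real.pi) * n := by rw [hn]; ring
      exact mul_left_cancel₀ (by positivity) h3
    have : q = n := by exact_mod_cast h2
    simp [this]
  let ψ : AddCircle (1 : ℚ) →+ Additive Circle :=
    QuotientAddGroup.lift (AddSubgroup.zmultiples (1 : ℚ)) ι (by
      rintro _ ⟨n, rfl⟩
      change Circle.exp _ = 1
      exact Circle.exp_eq_one.2 ⟨n, by simp; ring⟩)
  have hψ : ∀ z, ψ z = 0 → z = 0 := by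
    intro z
    induction z using QuotientAddGroup.induction_on with | _ q
    intro hz
    exact (QuotientAddGroup.eq_zero_iff q).2 (hι q hz)
  exact ⟨MonoidHom.toAdditive.symm (ψ.comp φ), fun h => hφ (hψ _ h)⟩

open MeasureTheory in
/-- A nontrivial continuous character of a compact group has Haar integral zero. -/
theorem integral_character_eq_zero {K : Type*} [CommGroup K] [TopologicalSpace K]
    [IsTopologicalGroup K] [MeasurableSpace K] [BorelSpace K] (μ : Measure K)
    [μ.IsMulLeftInvariant] {χ : K →ₜ* Circle} (hχ : χ ≠ 1) : ∫ x, (χ x : ℂ) ∂μ = 0 := by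
  obtain ⟨y, hy⟩ : ∃ y, χ y ≠ 1 := by
    by_contra! h
    exact hχ (ContinuousMonoidHom.ext h)
  have h := integral_mul_left_eq_self (μ := μ) (fun x => (χ x : ℂ)) y
  simp only [map_mul, Circle.coe_mul] at h
  rw [integral_const_mul] at h
  by_contra h0
  exact hy (Circle.ext (by simpa using mul_right_cancel₀ h0 (h.trans (one_mul _).symm)))

open MeasureTheory in
/-- A point-separating group of characters of a compact abelian group contains every character:
its linear span is uniformly dense by the Stone–Weierstrass theorem, while a character outside
the group would be orthogonal to it. -/
theorem mem_of_separates_points {K : Type*} [CommGroup K] [TopologicalSpace K]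
    [IsTopologicalGroup K] [CompactSpace K] (A : Subgroup (K →ₜ* Circle))
    (hA : ∀ x y : K, x ≠ y → ∃ f ∈ A, f x ≠ f y) (χ : K →ₜ* Circle) : χ ∈ A := by
  by_contra hχ
  borelize K
  let μ : Measure K := Measure.haar
  let toC : (K →ₜ* Circle) → C(K, ℂ) := fun f =>
    ⟨fun x => (f x : ℂ), continuous_subtype_val.comp f.continuous_toFun⟩
  let E : StarSubalgebra ℂ C(K, ℂ) :=
    { toSubalgebra := Algebra.adjoin ℂ (toC '' A)
      star_mem' := by
        change Algebra.adjoin ℂ (toC '' A) ≤ star (Algebra.adjoin ℂ (toC '' A))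
        refine Algebra.adjoin_le ?_
        rintro - ⟨f, hf, rfl⟩
        refine Algebra.subset_adjoin ⟨f⁻¹, A.inv_mem hf, ?_⟩
        ext x
        exact Circle.coe_inv_eq_conj (f x) }
  have hE : Subalgebra.toSubmodule E.toSubalgebra = Submodule.span ℂ (toC '' A) := by
    refine Algebra.adjoin_eq_span_of_subset ℂ (Subset.trans ?_ Submodule.subset_span)
    intro x hx
    refine Submonoid.closure_induction (fun _ => id) ⟨1, A.one_mem, ?_⟩ ?_ hx
    · ext1 z; rfl
    · rintro - - - - ⟨f, hf, rfl⟩ ⟨g, hg, rfl⟩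
      exact ⟨f * g, A.mul_mem hf hg, by ext1 z; rfl⟩
  have hsep : E.SeparatesPoints := by
    intro x y hxy
    obtain ⟨f, hf, hfxy⟩ := hA x y hxy
    exact ⟨_, ⟨toC f, Algebra.subset_adjoin ⟨f, hf, rfl⟩, rfl⟩, fun h => hfxy (Circle.ext h)⟩
  have hdense := ContinuousMap.starSubalgebra_topologicalClosure_eq_top_of_separatesPoints E hsep
  have hint : ∀ f : C(K, ℂ), Integrable f μ := fun f =>
    f.continuous.integrable_of_hasCompactSupport (HasCompactSupport.of_compactSpace f)
  -- `A` is orthogonal to `χ`, because `f χ⁻¹` is a nontrivial character for every `f` in `A`.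
  have horth : ∀ f ∈ Submodule.span ℂ (toC '' A), ∫ x, (f * toC χ⁻¹) x ∂μ = 0 := by
    intro f hf
    induction hf using Submodule.span_induction with
    | mem f hf =>
      obtain ⟨f, hf, rfl⟩ := hf
      have hne : f * χ⁻¹ ≠ 1 := fun h => hχ (by rwa [mul_inv_eq_one.1 h] at hf)
      exact integral_character_eq_zero μ hne
    | zero => simp
    | add f g _ _ ihf ihg =>
      have h := integral_add (hint (f * toC χ⁻¹)) (hint (g * toC χ⁻¹))
      rw [ihf, ihg, add_zero] at h
      rw [add_mul]
      exact h
    | smul a f _ ih =>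
      have h := integral_const_mul (μ := μ) a (fun x => (f * toC χ⁻¹) x)
      rw [ih, mul_zero] at h
      rw [smul_mul_assoc]
      exact h
  have hmem : toC χ ∈ closure (E : Set C(K, ℂ)) := by
    have : toC χ ∈ E.topologicalClosure := by rw [hdense]; trivial
    exact this
  have hcont : Continuous (fun f : C(K, ℂ) => ∫ x, (f * toC χ⁻¹) x ∂μ) := by
    have h1 := (ContinuousMap.toLp (E := ℂ) 1 μ ℂ).continuous
    have h2 := continuous_integral.comp (h1.comp (continuous_mul_const (toC χ⁻¹)))
    exact h2.congr fun f => integral_congr_ae (ContinuousMap.coeFn_toLp μ (f * toC χ⁻¹))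
  -- By density `χ` would be orthogonal to itself.
  have hzero : ∫ x, (toC χ * toC χ⁻¹) x ∂μ = 0 :=
    closure_minimal (s := (E : Set C(K, ℂ))) (fun f hf => horth f (by rw [← hE]; exact hf))
      (isClosed_singleton.preimage hcont) hmem
  have hone : ∀ x, (toC χ * toC χ⁻¹) x = 1 := fun x => by
    change ((χ x * (χ x)⁻¹ : Circle) : ℂ) = 1
    rw [mul_inv_cancel, Circle.coe_one]
  simp only [hone, integral_const] at hzero
  have hμ : μ.real univ ≠ 0 := by
    rw [Measure.real, ENNReal.toReal_ne_zero]
    exact ⟨(isOpen_univ.measure_pos μ univ_nonempty).ne', isCompact_univ.measure_lt_top.ne⟩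
  exact hμ (by simpa using hzero)

/-- Pontryagin duality for a discrete abelian group, surjectivity: every continuous character of the
dual group is the evaluation at a point. -/
theorem exists_eq_eval_of_discrete {A : Type*} [CommGroup A] [TopologicalSpace A]
    [DiscreteTopology A] (χ : PontryaginDual A →ₜ* Circle) : ∃ a : A, ∀ f, χ f = f a := by
  let ε : A →* (PontryaginDual A →ₜ* Circle) :=
    { toFun := fun a =>
        { toFun := fun f => f a
          map_one' := rfl
          map_mul' := fun _ _ => rfl
          continuous_toFun := continuous_eval_const (F := A →ₜ* Circle) a }
      map_one' := ContinuousMonoidHom.ext fun f => map_one f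
      map_mul' := fun a b => ContinuousMonoidHom.ext fun f => map_mul f a b }
  obtain ⟨a, rfl⟩ := mem_of_separates_points ε.range (fun f g hfg => by
    by_contra! h
    exact hfg (PontryaginDual.ext fun a => h (ε a) ⟨a, rfl⟩)) χ
  exact ⟨a, fun _ => rfl⟩

/-! ### The evaluation pairing of a bundle with its dual -/

namespace AbGroupBundle

variable {X : Type u} [TopologicalSpace X] {B : AbGroupBundle X}

open Classical in
/-- The evaluation `(t, b) ↦ t(b)` as a total function on pairs of total spaces; it has the value
`1` on pairs that lie over different base points. -/
noncomputable def pairE (t : B.DualE) (b : B.E) : Circle :=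
  if h : B.π b = t.base then t.char ⟨b, h⟩ else 1

theorem pairE_apply {t : B.DualE} {b : B.E} (h : B.π b = t.base) :
    pairE t b = t.char ⟨b, h⟩ := dif_pos h

theorem pairE_fib {x : X} (d : B.dual.Fib x) (a : B.Fib x) : pairE d.1 a.1 = pair d a :=
  pairE_apply _

theorem dualE_ext {t t' : B.DualE} (hb : t.base = t'.base)
    (h : ∀ b, B.π b = t.base → pairE t b = pairE t' b) : t = t' := by
  obtain ⟨x, f⟩ := t
  obtain ⟨y, g⟩ := t'
  obtain rfl : x = y := hb
  congr 1
  refine ContinuousMonoidHom.ext fun a => ?_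
  have := h a.1 a.2
  rwa [pairE_apply a.2, pairE_apply a.2] at this

/-- Over a Hausdorff base, a map into the dual bundle is continuous as soon as its base map and the
associated evaluations are. -/
theorem continuous_dualE_of_continuousOn [T2Space X] {Y : Type*} [TopologicalSpace Y]
    {f : Y → B.DualE} (hb : Continuous fun y => (f y).base)
    (hf : ContinuousOn (fun p : Y × B.E => pairE (f p.1) p.2) {p | B.π p.2 = (f p.1).base}) :
    Continuous f := by
  refine continuous_generateFrom_iff.2 ?_
  rintro W (⟨U, hU, rfl⟩ | ⟨K, V, hK, hV, rfl⟩)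
  · exact hU.preimage hb
  · refine isOpen_iff_mem_nhds.2 fun y hy => ?_
    have key : ∀ᶠ y' in 𝓝 y, ∀ a ∈ K, B.π a = (f y').base → pairE (f y') a ∈ V := by
      refine hK.eventually_forall_of_forall_eventually fun a ha => ?_
      by_cases hab : B.π a = (f y).base
      · have h1 := hf (y, a) hab
        have h2 : pairE (f y) a ∈ V := by rw [pairE_apply hab]; exact hy ⟨a, hab⟩ ha
        exact eventually_nhdsWithin_iff.1 (h1.eventually (hV.mem_nhds h2))
      · have h1 : IsOpen {p : Y × B.E | B.π p.2 ≠ (f p.1).base} :=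
          isOpen_ne_fun (B.continuous_π.comp continuous_snd) (hb.comp continuous_fst)
        filter_upwards [h1.mem_nhds (show (y, a) ∈ _ from hab)] with p hp h
        exact absurd h hp
    filter_upwards [key] with y' h a ha
    have := h a.1 ha a.2
    rwa [pairE_apply a.2] at this

/-- The evaluation of a locally compact bundle is continuous on the fibre product. -/
theorem continuousOn_pairE [LocallyCompactSpace B.E] :
    ContinuousOn (fun p : B.DualE × B.E => pairE p.1 p.2) {p | B.π p.2 = p.1.base} := by
  rintro ⟨t, a⟩ (hta : B.π a = t.base)
  refine Filter.tendsto_def.2 fun V hV => ?_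
  obtain ⟨V', hV'V, hV', hm⟩ := mem_nhds_iff.1 hV
  have hm' : t.char ⟨a, hta⟩ ∈ V' := by rwa [← pairE_apply hta]
  obtain ⟨W, hW, hWV⟩ := isOpen_induced_iff.1 (hV'.preimage t.char.continuous_toFun)
  have haW : a ∈ W := (hWV.symm ▸ hm' : (⟨a, hta⟩ : B.Fib t.base) ∈ Subtype.val ⁻¹' W)
  obtain ⟨K, hK, hKW, hKc⟩ := local_compact_nhds (hW.mem_nhds haW)
  refine mem_nhdsWithin_iff_eventually.2 ?_
  have h1 : B.dualNhd K V' ∈ 𝓝 t := (B.isOpen_dualNhd hKc hV').mem_nhds fun b hb => by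
    have : b ∈ (Subtype.val ⁻¹' W : Set (B.Fib t.base)) := hKW hb
    rw [hWV] at this
    exact this
  filter_upwards [prod_mem_nhds h1 hK] with p hp hpb
  refine hV'V ?_
  change pairE p.1 p.2 ∈ V'
  rw [pairE_apply hpb]
  exact hp.1 _ hp.2

/-- The evaluation along continuous maps into a locally compact bundle and its dual. -/
theorem continuousOn_pairE_comp [LocallyCompactSpace B.E] {Y : Type*} [TopologicalSpace Y]
    {f : Y → B.DualE} {g : Y → B.E} {D : Set Y} (hf : ContinuousOn f D) (hg : ContinuousOn g D)
    (h : ∀ y ∈ D, B.π (g y) = (f y).base) : ContinuousOn (fun y => pairE (f y) (g y)) D :=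
  continuousOn_pairE.comp (hf.prodMk hg) h

@[simp] theorem base_evE (a : B.E) : (evE a : B.dual.DualE).base = B.π a := rfl

theorem pairE_evE {a : B.E} {t : B.DualE} (h : t.base = B.π a) :
    pairE (B := B.dual) (evE a) t = pairE t a := by
  rw [pairE_apply (B := B.dual) (show B.dual.π t = (evE a : B.dual.DualE).base from h)]
  exact (pairE_fib (⟨t, h⟩ : B.dual.Fib (B.π a)) ⟨a, rfl⟩).symm

theorem continuous_evE [T2Space X] [LocallyCompactSpace B.E] :
    Continuous (evE : B.E → B.dual.dual.E) := by
  refine continuous_dualE_of_continuousOn (B := B.dual) B.continuous_π ?_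
  refine (continuousOn_pairE_comp (B := B) (f := fun p : B.E × B.DualE => p.2)
    (g := fun p : B.E × B.DualE => p.1) continuous_snd.continuousOn continuous_fst.continuousOn
    fun p hp => Eq.symm hp).congr ?_
  rintro ⟨a, t⟩ h
  exact pairE_evE h

theorem ev_mul {x : X} (a b : B.Fib x) : ev (a * b) = ev a * ev b :=
  dual_fib_ext fun d => by
    rw [pair_mul_left]
    exact pair_mul_right d a b

@[simp] theorem pair_ev {x : X} (a : B.Fib x) (d : B.dual.Fib x) : pair (ev a) d = pair d a := rfl

theorem ev_one {x : X} : ev (1 : B.Fib x) = 1 :=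
  dual_fib_ext fun d => pair_one_right d

theorem ev_inv {x : X} (a : B.Fib x) : ev a⁻¹ = (ev a)⁻¹ := by
  rw [eq_inv_iff_mul_eq_one, ← ev_mul, inv_mul_cancel, ev_one]

theorem evE_val {x : X} (a : B.Fib x) : evE a.1 = (ev a).1 := by
  obtain ⟨a, rfl⟩ := a
  rfl

theorem reb_ev {x y : X} (h : x = y) (a : B.Fib x) :
    (reb h (ev a) : B.dual.dual.Fib y) = ev (reb h a) := by
  subst h
  rfl

/-! ### Étale bundles -/

/-- Two families of points of an étale bundle that converge to the same point and eventually have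
the same base points are eventually equal. -/
theorem eventuallyEq_of_tendsto (hπ : IsLocalHomeomorph B.π) {Y : Type*} {l : Filter Y}
    {f g : Y → B.E} {a : B.E} (hf : Filter.Tendsto f l (𝓝 a)) (hg : Filter.Tendsto g l (𝓝 a))
    (h : ∀ᶠ y in l, B.π (f y) = B.π (g y)) : f =ᶠ[l] g := by
  obtain ⟨e, ha, he⟩ := hπ a
  have hs := e.open_source.mem_nhds ha
  filter_upwards [hf hs, hg hs, h] with y h1 h2 h3
  exact e.injOn h1 h2 (by rw [← he]; exact h3)

/-- A local section through a point of an étale bundle. -/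
theorem exists_localSection (hπ : IsLocalHomeomorph B.π) (a : B.E) :
    ∃ σ : X → B.E, Filter.Tendsto σ (𝓝 (B.π a)) (𝓝 a) ∧ ∀ᶠ x in 𝓝 (B.π a), B.π (σ x) = x := by
  obtain ⟨e, ha, he⟩ := hπ a
  refine ⟨e.symm, ?_, ?_⟩
  · have h := (e.continuousAt_symm (e.map_source ha)).tendsto
    rw [e.left_inv ha] at h
    rw [he]
    exact h
  · rw [he]
    filter_upwards [e.open_target.mem_nhds (e.map_source ha)] with x hx
    exact e.right_inv hx

theorem discreteTopology_fib (hπ : IsLocalHomeomorph B.π) (x : X) :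
    DiscreteTopology (B.Fib x) := by
  refine discreteTopology_iff_isOpen_singleton.2 fun a => ?_
  obtain ⟨e, ha, he⟩ := hπ a.1
  convert e.open_source.preimage (continuous_subtype_val : Continuous (Subtype.val : B.Fib x → _))
    using 1
  ext b
  refine ⟨fun h => h ▸ ha, fun h => Subtype.ext (e.injOn h ha ?_)⟩
  rw [← he, b.2, a.2]

/-- Characters separate the points of the fibres of an étale bundle. -/
theorem exists_pair_ne_one (hπ : IsLocalHomeomorph B.π) {x : X} {a : B.Fib x} (ha : a ≠ 1) :
    ∃ d : B.dual.Fib x, pair d a ≠ 1 := by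
  have := discreteTopology_fib hπ x
  obtain ⟨f, hf⟩ := exists_monoidHom_circle_apply_ne_one ha
  exact ⟨⟨⟨x, ⟨f, continuous_of_discreteTopology⟩⟩, rfl⟩, hf⟩

theorem ev_injective (hπ : IsLocalHomeomorph B.π) {x : X} :
    Function.Injective (ev : B.Fib x → B.dual.dual.Fib x) := by
  intro a b hab
  by_contra h
  obtain ⟨d, hd⟩ := exists_pair_ne_one hπ (a := a * b⁻¹) (by rwa [Ne, mul_inv_eq_one])
  apply hd
  rw [← pair_ev, ev_mul, ev_inv, hab, mul_inv_cancel, pair_one_left]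

/-- Fibrewise Pontryagin duality: the fibres of an étale bundle are discrete groups. -/
theorem ev_surjective [T2Space X] (hπ : IsLocalHomeomorph B.π) {x : X} :
    Function.Surjective (ev : B.Fib x → B.dual.dual.Fib x) := by
  intro χ
  have := discreteTopology_fib hπ x
  let j : PontryaginDual (B.Fib x) → B.dual.Fib x := fun f => ⟨⟨x, f⟩, rfl⟩
  have hj : Continuous j := by
    refine Continuous.subtype_mk (continuous_dualE_of_continuousOn (Y := PontryaginDual (B.Fib x))
      (f := fun f => (⟨x, f⟩ : B.DualE)) continuous_const ?_) _
    rw [continuousOn_iff_continuous_domRestrict]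
    have h : Continuous fun p : PontryaginDual (B.Fib x) × B.Fib x => p.1 p.2 :=
      continuous_eval (F := B.Fib x →ₜ* Circle)
    refine (h.comp (f := fun p : ↥{p : PontryaginDual (B.Fib x) × B.E | B.π p.2 = x} =>
      (p.1.1, (⟨p.1.2, p.2⟩ : B.Fib x))) ((continuous_fst.comp continuous_subtype_val).prodMk
        ((continuous_snd.comp continuous_subtype_val).subtype_mk _))).congr fun p => ?_
    exact (pairE_apply (t := ⟨x, p.1.1⟩) p.2).symm
  obtain ⟨a, ha⟩ := exists_eq_eval_of_discrete (A := B.Fib x)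
    { toFun := fun f => pair χ (j f)
      map_one' := pair_one_right χ
      map_mul' := fun f g => pair_mul_right χ (j f) (j g)
      continuous_toFun := (continuous_pair_right χ).comp hj }
  refine ⟨a, dual_fib_ext fun d => ?_⟩
  obtain ⟨⟨y, f⟩, rfl⟩ := d
  exact (ha f).symm

theorem evE_bijective [T2Space X] (hπ : IsLocalHomeomorph B.π) :
    Function.Bijective (evE : B.E → B.dual.dual.E) := by
  constructor
  · intro a b hab
    have hx : B.π a = B.π b := congrArg DualE.base hab
    have : (⟨a, hx⟩ : B.Fib (B.π b)) = ⟨b, rfl⟩ := by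
      refine ev_injective hπ (Subtype.ext ?_)
      rw [← evE_val, ← evE_val]
      exact hab
    exact congrArg Subtype.val this
  · intro χ
    obtain ⟨a, ha⟩ := ev_surjective hπ (⟨χ, rfl⟩ : B.dual.dual.Fib (B.dual.dual.π χ))
    exact ⟨a.1, by rw [evE_val, ha]⟩

/-! ### Pontryagin duality for étale bundles -/

open Classical in
/-- The product of two points of the same fibre, as a total function on the total space; it has no
meaning on pairs of points that lie over different base points. -/
noncomputable def mulE (a b : B.E) : B.E :=
  if h : B.π a = B.π b then ((⟨a, h⟩ : B.Fib (B.π b)) * ⟨b, rfl⟩).1 else a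

theorem mulE_val {x : X} (a b : B.Fib x) : mulE a.1 b.1 = (a * b).1 := by
  obtain ⟨b, rfl⟩ := b
  exact dif_pos a.2

theorem pairE_mulE {t : B.DualE} {a b : B.E} (ha : B.π a = t.base) (hb : B.π b = t.base) :
    pairE t (mulE a b) = pairE t a * pairE t b := by
  have h := mulE_val (⟨a, ha⟩ : B.Fib t.base) ⟨b, hb⟩
  dsimp only at h
  rw [h, pairE_apply ha, pairE_apply hb, pairE_apply (_ * _ : B.Fib t.base).2]
  exact map_mul t.char _ _

/-- The dual of an étale bundle with continuous multiplication is proper over the base: along an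
ultrafilter of characters whose base points converge to `x`, the values at local sections converge,
and the limits form a character of the fibre over `x`. -/
theorem isCompact_preimage_base [T2Space X] (hπ : IsLocalHomeomorph B.π)
    (hmul : ContinuousOn (fun p : B.E × B.E => mulE p.1 p.2) {p | B.π p.1 = B.π p.2})
    {C : Set X} (hC : IsCompact C) : IsCompact (DualE.base ⁻¹' C : Set B.DualE) := by
  refine isCompact_iff_ultrafilter_le_nhds.2 fun F hF => ?_
  obtain ⟨x, hxC, hx⟩ := isCompact_iff_ultrafilter_le_nhds.1 hC (F.map DualE.base) (by
    simpa using hF)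
  replace hx : Filter.Tendsto DualE.base (F : Filter B.DualE) (𝓝 x) := hx
  have hsec : ∀ a : B.Fib x, ∃ g : B.DualE → B.E, Filter.Tendsto g F (𝓝 a.1) ∧
      ∀ᶠ t in (F : Filter B.DualE), B.π (g t) = t.base := by
    rintro ⟨a, rfl⟩
    obtain ⟨σ, h1, h2⟩ := exists_localSection hπ a
    exact ⟨fun t => σ t.base, h1.comp hx, hx.eventually h2⟩
  choose g hg hgb using hsec
  let L : B.Fib x → Circle := fun a => (F.map fun t => pairE t (g a t)).lim
  -- The limit does not depend on the local section, as two of them have the same germ at `x`.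
  have hL : ∀ (a : B.Fib x) (k : B.DualE → B.E), Filter.Tendsto k F (𝓝 a.1) →
      (∀ᶠ t in (F : Filter B.DualE), B.π (k t) = t.base) →
      Filter.Tendsto (fun t => pairE t (k t)) F (𝓝 (L a)) := by
    intro a k hk hkb
    have h1 : Filter.Tendsto (fun t => pairE t (g a t)) F (𝓝 (L a)) := Ultrafilter.le_nhds_lim _
    refine h1.congr' ?_
    filter_upwards [eventuallyEq_of_tendsto hπ (hg a) hk
      (by filter_upwards [hgb a, hkb] with t h h' using h.trans h'.symm)] with t ht
    rw [ht]
  have hLmul : ∀ a b, L (a * b) = L a * L b := by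
    intro a b
    have hab : B.π a.1 = B.π b.1 := a.2.trans b.2.symm
    have h1 : Filter.Tendsto (fun t => mulE (g a t) (g b t)) F (𝓝 (a * b).1) := by
      have h := hmul (a.1, b.1) hab
      rw [ContinuousWithinAt, mulE_val] at h
      refine h.comp (tendsto_nhdsWithin_iff.2 ⟨(hg a).prodMk_nhds (hg b), ?_⟩)
      filter_upwards [hgb a, hgb b] with t h h' using h.trans h'.symm
    have h2 := hL (a * b) _ h1 (by
      filter_upwards [hgb a, hgb b] with t h h'
      have h3 := mulE_val (⟨g a t, h⟩ : B.Fib t.base) ⟨g b t, h'⟩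
      dsimp only at h3
      rw [h3]
      exact (_ * _ : B.Fib t.base).2)
    refine tendsto_nhds_unique h2 (((hL a _ (hg a) (hgb a)).mul (hL b _ (hg b) (hgb b))).congr' ?_)
    filter_upwards [hgb a, hgb b] with t h h' using (pairE_mulE h h').symm
  have := discreteTopology_fib hπ x
  let χ : B.Fib x →ₜ* Circle := ⟨MonoidHom.mk' L hLmul, continuous_of_discreteTopology⟩
  refine ⟨⟨x, χ⟩, hxC, ?_⟩
  refine (TopologicalSpace.tendsto_nhds_generateFrom_iff (f := (F : Filter B.DualE)) (m := id)).2 ?_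
  rintro W (⟨U, hU, rfl⟩ | ⟨K, V, hK, hV, rfl⟩) hW
  · exact hx.eventually (hU.mem_nhds hW)
  · have key : ∀ᶠ t in (F : Filter B.DualE), ∀ b ∈ K, B.π b = t.base → pairE t b ∈ V := by
      refine hK.induction_on (p := fun s => ∀ᶠ t in (F : Filter B.DualE), ∀ b ∈ s,
        B.π b = t.base → pairE t b ∈ V) (by simp) ?_ ?_ ?_
      · intro s s' hss h
        filter_upwards [h] with t ht b hb using ht b (hss hb)
      · intro s s' h h'
        filter_upwards [h, h'] with t ht ht' b hb
        exact hb.elim (ht b) (ht' b)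
      · intro a ha
        by_cases hax : B.π a = x
        · obtain ⟨e, hae, he⟩ := hπ a
          refine ⟨e.source, mem_nhdsWithin_of_mem_nhds (e.open_source.mem_nhds hae), ?_⟩
          have h1 := hL ⟨a, hax⟩ _ (hg ⟨a, hax⟩) (hgb ⟨a, hax⟩)
          filter_upwards [hg ⟨a, hax⟩ (e.open_source.mem_nhds hae), hgb ⟨a, hax⟩,
            h1.eventually (hV.mem_nhds (hW ⟨a, hax⟩ ha))] with t h2 h3 h4 b hb hbt
          have : b = g ⟨a, hax⟩ t := e.injOn hb h2 (by rw [← he, hbt, h3])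
          rw [this]
          exact h4
        · obtain ⟨U, U', hU, hU', haU, hxU', hd⟩ := t2_separation hax
          refine ⟨B.π ⁻¹' U, mem_nhdsWithin_of_mem_nhds
            ((hU.preimage B.continuous_π).mem_nhds haU), ?_⟩
          filter_upwards [hx.eventually (hU'.mem_nhds hxU')] with t ht b hb hbt
          exact absurd ht (disjoint_left.1 hd (hbt ▸ hb))
    filter_upwards [key] with t h a ha
    have := h a.1 ha a.2
    rwa [pairE_apply (t := t) a.2] at this

theorem t2Space_dualE [T2Space X] [LocallyCompactSpace B.E] (hπ : IsLocalHomeomorph B.π) :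
    T2Space B.DualE := by
  refine t2_iff_ultrafilter.2 fun {t t'} F h h' => ?_
  have hb : t.base = t'.base :=
    tendsto_nhds_unique (B.continuous_base.tendsto t |>.comp h)
      (B.continuous_base.tendsto t' |>.comp h')
  refine dualE_ext hb fun b hbt => ?_
  obtain ⟨σ, hσ, hσb⟩ := exists_localSection hπ b
  have key : ∀ t₀ : B.DualE, t₀.base = B.π b → (F : Filter B.DualE) ≤ 𝓝 t₀ →
      Filter.Tendsto (fun u : B.DualE => pairE u (σ u.base)) F (𝓝 (pairE t₀ b)) := by
    intro t₀ h0 hF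
    have h1 : Filter.Tendsto DualE.base (F : Filter B.DualE) (𝓝 (B.π b)) := by
      rw [← h0]
      exact (B.continuous_base.tendsto t₀).mono_left hF
    refine (continuousOn_pairE (t₀, b) h0.symm).tendsto.comp
      (f := fun u : B.DualE => (u, σ u.base)) (tendsto_nhdsWithin_iff.2 ⟨?_, h1.eventually hσb⟩)
    exact Filter.Tendsto.prodMk_nhds hF (hσ.comp h1)
  exact tendsto_nhds_unique (key t hbt.symm h) (key t' (hb.symm.trans hbt.symm) h')

theorem locallyCompactSpace_dualE [T2Space X] [LocallyCompactSpace X] [LocallyCompactSpace B.E]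
    (hπ : IsLocalHomeomorph B.π)
    (hmul : ContinuousOn (fun p : B.E × B.E => mulE p.1 p.2) {p | B.π p.1 = B.π p.2}) :
    LocallyCompactSpace B.DualE := by
  have := t2Space_dualE hπ
  have : WeaklyLocallyCompactSpace B.DualE := by
    refine ⟨fun t => ?_⟩
    obtain ⟨C, hC, hCt⟩ := exists_compact_mem_nhds t.base
    exact ⟨_, isCompact_preimage_base hπ hmul hC, B.continuous_base.continuousAt hCt⟩
  infer_instance

/-- Two points of the bidual over the same base point that are uniformly close are equal, since the
circle has no small subgroups. -/
theorem eq_of_forall_mem_centeredArc {x : X} {χ ν : B.dual.dual.Fib x}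
    (h : ∀ d, pair χ d * (pair ν d)⁻¹ ∈ Circle.centeredArc (Real.pi / 2)) : χ = ν := by
  refine dual_fib_ext fun d => mul_inv_eq_one.1
    (Circle.eq_one_of_forall_pow_mem_centeredArc_pi_div_two fun n _ => ?_)
  have hpow : ∀ ξ : B.dual.dual.Fib x, pair ξ (d ^ n) = pair ξ d ^ n := fun ξ =>
    map_pow (MonoidHom.mk' (fun d => pair ξ d) (pair_mul_right ξ)) d n
  have := h (d ^ n)
  rwa [hpow, hpow, ← inv_pow, ← mul_pow] at this

/-- A point of the bidual near `evE a` is the evaluation at a local section through `a`: it is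
uniformly close to that evaluation on the compact set of characters over a neighbourhood of the
base point. -/
theorem isOpenMap_evE [T2Space X] [LocallyCompactSpace X] [LocallyCompactSpace B.E]
    (hπ : IsLocalHomeomorph B.π)
    (hmul : ContinuousOn (fun p : B.E × B.E => mulE p.1 p.2) {p | B.π p.1 = B.π p.2}) :
    IsOpenMap (evE : B.E → B.dual.dual.E) := by
  have : LocallyCompactSpace B.dual.E := locallyCompactSpace_dualE hπ hmul
  refine isOpenMap_iff_nhds_le.2 fun a => ?_
  obtain ⟨σ, hσ, hσb⟩ := exists_localSection hπ a
  obtain ⟨C, hC, hCa⟩ := exists_compact_mem_nhds (B.π a)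
  have hbase : Filter.Tendsto B.dual.dual.π (𝓝 (evE a)) (𝓝 (B.π a)) :=
    B.dual.dual.continuous_π.tendsto (evE a)
  -- Over `C`, a point `χ` near `evE a` is uniformly close to the evaluation at the section `σ`.
  have key : ∀ᶠ χ in 𝓝 (evE a : B.dual.dual.E), ∀ t ∈ (DualE.base ⁻¹' C : Set B.DualE),
      t.base = B.dual.dual.π χ → pairE (B := B.dual) χ t * (pairE t (σ (B.dual.dual.π χ)))⁻¹ ∈
        Circle.centeredArc (Real.pi / 2) := by
    refine (isCompact_preimage_base hπ hmul hC).eventually_forall_of_forall_eventually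
      fun t ht => ?_
    by_cases hta : t.base = B.π a
    · have h1 := continuousOn_pairE (B := B.dual) (evE a, t) hta
      have h2 := (continuousOn_pairE (t, a) hta.symm).tendsto.comp
        (f := fun p : B.dual.dual.E × B.DualE => (p.2, σ (B.dual.dual.π p.1)))
        (x := 𝓝[{p : B.dual.dual.E × B.DualE | p.2.base = B.dual.dual.π p.1}] (evE a, t))
        (by
          have h3 : Filter.Tendsto (fun p : B.dual.dual.E × B.DualE => B.dual.dual.π p.1)
              (𝓝[{p : B.dual.dual.E × B.DualE | p.2.base = B.dual.dual.π p.1}] (evE a, t))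
              (𝓝 (B.π a)) :=
            hbase.comp ((continuous_fst.tendsto (evE a, t)).mono_left nhdsWithin_le_nhds)
          refine tendsto_nhdsWithin_iff.2 ⟨Filter.Tendsto.prodMk_nhds
            ((continuous_snd.tendsto (evE a, t)).mono_left nhdsWithin_le_nhds) (hσ.comp h3), ?_⟩
          filter_upwards [h3.eventually hσb, self_mem_nhdsWithin] with p hp hp'
          exact hp.trans (Eq.symm hp'))
      have h4 := h1.tendsto.mul h2.inv
      refine eventually_nhdsWithin_iff.1 (h4.eventually
        ((Circle.isOpen_centeredArc (Real.pi / 2)).mem_nhds ?_))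
      dsimp only
      rw [pairE_evE hta, mul_inv_cancel, Circle.mem_centeredArc (by linarith [Real.pi_pos])]
      simp [Real.pi_pos]
    · have h1 : IsOpen {p : B.dual.dual.E × B.DualE | p.2.base ≠ B.dual.dual.π p.1} :=
        isOpen_ne_fun (B.continuous_base.comp continuous_snd)
          (B.dual.dual.continuous_π.comp continuous_fst)
      filter_upwards [h1.mem_nhds (show (evE a, t) ∈ _ from hta)] with p hp h
      exact absurd h hp
  have hev : ∀ᶠ χ in 𝓝 (evE a : B.dual.dual.E), evE (σ (B.dual.dual.π χ)) = χ := by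
    filter_upwards [key, hbase.eventually hσb, hbase.eventually hCa] with χ h1 h2 h3
    have h4 := eq_of_forall_mem_centeredArc (B := B) (χ := ⟨χ, rfl⟩)
      (ν := ev (⟨σ (B.dual.dual.π χ), h2⟩ : B.Fib (B.dual.dual.π χ))) fun d => by
        rw [← pairE_fib, pair_ev, ← pairE_fib d]
        exact h1 d.1 (show B.dual.π d.1 ∈ C by rw [d.2]; exact h3) d.2
    exact (evE_val (⟨σ (B.dual.dual.π χ), h2⟩ : B.Fib (B.dual.dual.π χ))).trans
      (congrArg Subtype.val h4).symm
  intro s hs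
  filter_upwards [hev, (hσ.comp hbase) hs] with χ h1 h2
  rw [← h1]
  exact h2

/-- Pontryagin duality for étale bundles of abelian groups. -/
theorem isHomeomorph_evE [T2Space X] [LocallyCompactSpace X] [LocallyCompactSpace B.E]
    (hπ : IsLocalHomeomorph B.π)
    (hmul : ContinuousOn (fun p : B.E × B.E => mulE p.1 p.2) {p | B.π p.1 = B.π p.2}) :
    IsHomeomorph (evE : B.E → B.dual.dual.E) :=
  ⟨continuous_evE, isOpenMap_evE hπ hmul, evE_bijective hπ⟩

end AbGroupBundle

/-! ### Calculations in groupoids -/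

open GroupoidOps

namespace IsGroupoid

section

variable {G : Type u} [GroupoidOps G] [IsGroupoid G]

theorem mul_inv_rev' {g h : G} (e : s g = r h) : (g * h)⁻¹ = h⁻¹ * g⁻¹ := by
  have e1 : s h⁻¹ = r g⁻¹ := by rw [s_inv, r_inv, e]
  have e2 : s (g * h) = r (h⁻¹ * g⁻¹) := by rw [s_mul _ _ e, r_mul _ _ e1, r_inv]
  have h1 : (g * h) * (h⁻¹ * g⁻¹) = r g := by
    rw [assoc _ _ _ e (by rw [r_mul _ _ e1, r_inv]), mul_inv_cancel_left' (by rw [r_inv, e]),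
      mul_inv_self]
  rw [← inv_mul_cancel_left' e2, h1, ← r_mul _ _ e, ← s_inv, mul_s_self]

theorem inv_r (g : G) : (r g)⁻¹ = r g := by
  have h := r_mul_self (r g)⁻¹
  rw [r_inv, s_r] at h
  rw [← h, mul_inv_self, r_r]

theorem r_mul_of_eq {u g : G} (h : u = r g) : u * g = g := h ▸ r_mul_self g

end

section Transport

variable {K : Type u} {G : Type v} [GroupoidOps K] [GroupoidOps G] [IsGroupoid G]

/-- The groupoid axioms pull back along an injective map that respects the operations. -/
theorem of_injective {f : K → G} (hf : Function.Injective f) (hr : ∀ a, f (r a) = r (f a))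
    (hs : ∀ a, f (s a) = s (f a)) (hinv : ∀ a, f a⁻¹ = (f a)⁻¹)
    (hmul : ∀ a b, s a = r b → f (a * b) = f a * f b) : IsGroupoid K := by
  have hc : ∀ {a b : K}, s a = r b → s (f a) = r (f b) := fun h => by rw [← hs, ← hr, h]
  have hc' : ∀ {a b : K}, s (f a) = r (f b) → s a = r b := fun h => hf (by rw [hs, hr, h])
  constructor
  · exact fun g => hf (by simp only [hr, r_r])
  · exact fun g => hf (by simp only [hr, hs, s_r])
  · exact fun g => hf (by simp only [hr, hs, r_s])
  · exact fun g => hf (by simp only [hs, s_s])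
  · exact fun g h e => hf (by rw [hr, hr, hmul _ _ e, r_mul _ _ (hc e)])
  · exact fun g h e => hf (by rw [hs, hs, hmul _ _ e, s_mul _ _ (hc e)])
  · intro g h k e e'
    refine hf ?_
    have h1 : s (g * h) = r k := hc' (by rw [hmul _ _ e, s_mul _ _ (hc e), hc e'])
    have h2 : s g = r (h * k) := hc' (by rw [hmul _ _ e', r_mul _ _ (hc e'), hc e])
    rw [hmul _ _ h1, hmul _ _ h2, hmul _ _ e, hmul _ _ e', assoc _ _ _ (hc e) (hc e')]
  · exact fun g => hf (by rw [hmul _ _ (hc' (by rw [hr, s_r])), hr, r_mul_self])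
  · exact fun g => hf (by rw [hmul _ _ (hc' (by rw [hs, r_s])), hs, mul_s_self])
  · exact fun g => hf (by rw [hr, hs, hinv, r_inv])
  · exact fun g => hf (by rw [hr, hs, hinv, s_inv])
  · exact fun g => hf (by rw [hmul _ _ (hc' (by rw [hinv, r_inv])), hinv, hr, mul_inv_self])
  · exact fun g => hf (by rw [hmul _ _ (hc' (by rw [hinv, s_inv])), hinv, hs, inv_mul_self])

end Transport

end IsGroupoid

section Transport

variable {K : Type u} {G : Type v} [GroupoidOps K] [GroupoidOps G] [TopologicalSpace K]
  [TopologicalSpace G]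

open IsGroupoid

theorem IsTopologicalGroupoid.of_homeomorph [IsTopologicalGroupoid G] (f : K ≃ₜ G)
    (hr : ∀ a, f (r a) = r (f a))
    (hs : ∀ a, f (s a) = s (f a)) (hinv : ∀ a, f a⁻¹ = (f a)⁻¹)
    (hmul : ∀ a b, s a = r b → f (a * b) = f a * f b) : IsTopologicalGroupoid K where
  toIsGroupoid := IsGroupoid.of_injective f.injective hr hs hinv hmul
  continuousOn_mul := by
    have h : ContinuousOn (fun p : K × K => f.symm (f p.1 * f p.2)) {p | s p.1 = r p.2} :=
      f.symm.continuous.comp_continuousOn (continuousOn_mul.comp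
        (f := fun p : K × K => (f p.1, f p.2)) (by fun_prop)
        fun p hp => show s (f p.1) = r (f p.2) by rw [← hs, ← hr, hp])
    refine h.congr fun p hp => ?_
    change _ = f.symm _
    rw [← hmul _ _ hp, f.symm_apply_apply]
  continuous_inv := by
    have h : Continuous fun a : K => f.symm (f a)⁻¹ :=
      f.symm.continuous.comp (continuous_inv.comp f.continuous)
    refine h.congr fun a => ?_
    rw [← hinv, f.symm_apply_apply]

theorem isTopGroupoidIso_of_homeomorph (f : K ≃ₜ G) (hr : ∀ a, f (r a) = r (f a))
    (hs : ∀ a, f (s a) = s (f a)) (hmul : ∀ a b, s a = r b → f (a * b) = f a * f b) :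
    IsTopGroupoidIso f where
  hom := ⟨fun a b h => by rw [← hs, ← hr, h], hmul⟩
  hom_symm := by
    have hc : ∀ g h : G, s g = r h → s (f.symm g) = r (f.symm h) := fun g h e =>
      f.injective (by rw [hs, hr, f.apply_symm_apply, f.apply_symm_apply, e])
    refine ⟨hc, fun g h e => f.injective ?_⟩
    rw [hmul _ _ (hc g h e), f.apply_symm_apply, f.apply_symm_apply, f.apply_symm_apply]

theorem Continuous.groupoid_mul [IsTopologicalGroupoid G] {Y : Type*} [TopologicalSpace Y]
    {f g : Y → G} (hf : Continuous f) (hg : Continuous g) (h : ∀ y, s (f y) = r (g y)) :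
    Continuous fun y => f y * g y :=
  IsTopologicalGroupoid.continuousOn_mul.comp_continuous (hf.prodMk hg) h

end Transport

namespace NormalAbelianSubgroupoid

open IsGroupoid AbGroupBundle

/-! ### The quotient groupoid `G/S` -/

section Alg

variable {G : Type u} [GroupoidOps G] [IsGroupoid G] (N : NormalAbelianSubgroupoid G)

theorem cls_mul_carrier {g a : G} (ha : a ∈ N.carrier) (e : s g = r a) :
    N.cls (g * a) = N.cls g :=
  (Quotient.sound (s := N.setoid) ⟨a, ha, e, rfl⟩).symm

theorem exists_eq_mul_of_cls_eq {g h : G} (e : N.cls g = N.cls h) :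
    ∃ a ∈ N.carrier, s g = r a ∧ h = g * a :=
  Quotient.exact (s := N.setoid) e

theorem conj_mem {g a : G} (ha : a ∈ N.carrier) (e : r a = s g) : g * a * g⁻¹ ∈ N.carrier := by
  have h := N.normal g⁻¹ a ha (by rw [r_inv, e]) (by rw [← N.iso a ha, r_inv, e])
  rwa [inv_inv'] at h

theorem cls_inv (g : G) : (N.cls g)⁻¹ = N.cls g⁻¹ := by
  obtain ⟨a, ha, e, h⟩ := N.exists_eq_mul_of_cls_eq (N.cls_rep (N.cls g)).symm
  change N.cls (N.rep (N.cls g))⁻¹ = _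
  rw [h]
  have i := N.iso a ha
  have e1 : s (g * a) = r g⁻¹ := by rw [s_mul _ _ e, r_inv, e, i]
  rw [← N.cls_mul_carrier (N.conj_mem ha e.symm) (g := (g * a)⁻¹)
    (by rw [s_inv, r_mul _ _ e1]), inv_mul_cancel_left' e1]

theorem isGroupoid_Q : IsGroupoid N.Q := by
  have hc : ∀ {g h : G}, s (N.cls g) = r (N.cls h) → s g = r h := fun e => by
    have := congrArg N.sX e
    change N.sX (N.cls (N.sX _).1) = N.sX (N.cls (N.rX _).1) at this
    rw [sX_unit, sX_unit] at this
    exact congrArg Subtype.val this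
  have hcls : ∀ q : N.Q, ∃ g, N.cls g = q := fun q => ⟨_, N.cls_rep q⟩
  have hr : ∀ g : G, r (N.cls g) = N.cls (r g) := fun _ => rfl
  have hs : ∀ g : G, s (N.cls g) = N.cls (s g) := fun _ => rfl
  constructor
  · intro a
    obtain ⟨g, rfl⟩ := hcls a
    simp only [hr, r_r]
  · intro a
    obtain ⟨g, rfl⟩ := hcls a
    simp only [hr, hs, s_r]
  · intro a
    obtain ⟨g, rfl⟩ := hcls a
    simp only [hr, hs, r_s]
  · intro a
    obtain ⟨g, rfl⟩ := hcls a
    simp only [hs, s_s]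
  · intro a b e
    obtain ⟨g, rfl⟩ := hcls a
    obtain ⟨h, rfl⟩ := hcls b
    rw [N.cls_mul (hc e), hr, r_mul _ _ (hc e), hr]
  · intro a b e
    obtain ⟨g, rfl⟩ := hcls a
    obtain ⟨h, rfl⟩ := hcls b
    rw [N.cls_mul (hc e), hs, s_mul _ _ (hc e), hs]
  · intro a b d e e'
    obtain ⟨g, rfl⟩ := hcls a
    obtain ⟨h, rfl⟩ := hcls b
    obtain ⟨k, rfl⟩ := hcls d
    have e1 := hc e
    have e2 := hc e'
    rw [N.cls_mul e1, N.cls_mul e2, N.cls_mul (by rw [s_mul _ _ e1, e2]),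
      N.cls_mul (by rw [r_mul _ _ e2, e1]), assoc _ _ _ e1 e2]
  · intro a
    obtain ⟨g, rfl⟩ := hcls a
    rw [hr, N.cls_mul (s_r g), r_mul_self]
  · intro a
    obtain ⟨g, rfl⟩ := hcls a
    rw [hs, N.cls_mul (r_s g).symm, mul_s_self]
  · intro a
    obtain ⟨g, rfl⟩ := hcls a
    rw [cls_inv, hr, hs, r_inv]
  · intro a
    obtain ⟨g, rfl⟩ := hcls a
    rw [cls_inv, hr, hs, s_inv]
  · intro a
    obtain ⟨g, rfl⟩ := hcls a
    rw [cls_inv, N.cls_mul (r_inv g).symm, hr, mul_inv_self]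
  · intro a
    obtain ⟨g, rfl⟩ := hcls a
    rw [cls_inv, N.cls_mul (s_inv g), hs, inv_mul_self]

theorem sX_eq_of_s_eq_r {a b : N.Q} (e : s a = r b) : N.sX a = N.rX b := by
  have := congrArg N.sX e
  change N.sX (N.cls (N.sX a).1) = N.sX (N.cls (N.rX b).1) at this
  rwa [sX_unit, sX_unit] at this

end Alg

section Topological

variable {G : Type u} [GroupoidOps G] [TopologicalSpace G] [IsTopologicalGroupoid G]
  (N : NormalAbelianSubgroupoid G)

theorem continuous_s : Continuous (s : G → G) := by
  have h := (continuous_r (G := G)).comp IsTopologicalGroupoid.continuous_inv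
  exact h.congr fun g => r_inv g

theorem continuous_cls : Continuous N.cls := continuous_quotient_mk'

theorem continuous_sX : Continuous N.sX :=
  (continuous_s.subtype_mk _).quotient_lift _

theorem continuous_rX : Continuous N.rX :=
  (continuous_r.subtype_mk _).quotient_lift _

variable {N} in
theorem IsUnitalSection.r_apply {σ : N.Q → G} (hσ : N.IsUnitalSection σ) (q : N.Q) :
    r (σ q) = (N.rX q).1 := by rw [← rX_cls, hσ.cls_apply]

variable {N} in
theorem IsUnitalSection.s_apply {σ : N.Q → G} (hσ : N.IsUnitalSection σ) (q : N.Q) :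
    s (σ q) = (N.sX q).1 := by rw [← sX_cls, hσ.cls_apply]

/-- With a continuous section, products and inverses in `G/S` are computed continuously on the
representatives that the section selects. -/
theorem isTopologicalGroupoid_Q {σ : N.Q → G} (hσ : N.IsUnitalSection σ) :
    IsTopologicalGroupoid N.Q where
  toIsGroupoid := N.isGroupoid_Q
  continuousOn_mul := by
    have hc : ∀ p ∈ {p : N.Q × N.Q | s p.1 = r p.2}, s (σ p.1) = r (σ p.2) := fun p hp => by
      rw [hσ.s_apply, hσ.r_apply, N.sX_eq_of_s_eq_r hp]
    have h : ContinuousOn (fun p : N.Q × N.Q => N.cls (σ p.1 * σ p.2)) {p | s p.1 = r p.2} :=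
      N.continuous_cls.comp_continuousOn (IsTopologicalGroupoid.continuousOn_mul.comp
        (f := fun p : N.Q × N.Q => (σ p.1, σ p.2))
        ((hσ.continuous.comp continuous_fst).prodMk
          (hσ.continuous.comp continuous_snd)).continuousOn hc)
    refine h.congr fun p hp => ?_
    change p.1 * p.2 = N.cls (σ p.1 * σ p.2)
    rw [← N.cls_mul (hc p hp), hσ.cls_apply, hσ.cls_apply]
  continuous_inv := by
    have h : Continuous fun q : N.Q => N.cls (σ q)⁻¹ :=
      N.continuous_cls.comp (IsTopologicalGroupoid.continuous_inv.comp hσ.continuous)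
    refine h.congr fun q => ?_
    rw [← cls_inv, hσ.cls_apply]

/-! ### The bundle `S` is étale -/

theorem locallyCompactSpace_obj [T2Space G] [LocallyCompactSpace G] :
    LocallyCompactSpace (Obj G) :=
  (isClosed_eq continuous_r continuous_id).isClosedEmbedding_subtypeVal.locallyCompactSpace

theorem locallyCompactSpace_bundle [LocallyCompactSpace G] (hN : IsClosed N.carrier) :
    LocallyCompactSpace N.bundle.E :=
  hN.isClosedEmbedding_subtypeVal.locallyCompactSpace

theorem coe_mulE {a b : N.bundle.E} (h : N.bundle.π a = N.bundle.π b) :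
    (mulE a b).1 = a.1 * b.1 := by
  rw [show mulE a b = _ from mulE_val (⟨a, h⟩ : N.bundle.Fib (N.bundle.π b)) ⟨b, rfl⟩]
  rfl

theorem continuousOn_mulE_bundle :
    ContinuousOn (fun p : N.bundle.E × N.bundle.E => mulE p.1 p.2)
      {p | N.bundle.π p.1 = N.bundle.π p.2} := by
  have hv : Continuous (fun a : N.bundle.E => a.1) := continuous_subtype_val
  refine (IsInducing.subtypeVal (t := N.carrier)).continuousOn_iff.2 ?_
  refine ContinuousOn.congr (f := fun p : N.bundle.E × N.bundle.E => p.1.1 * p.2.1) ?_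
    fun p hp => N.coe_mulE hp
  refine IsTopologicalGroupoid.continuousOn_mul.comp
    (f := fun p : N.bundle.E × N.bundle.E => (p.1.1, p.2.1))
    ((hv.comp continuous_fst).prodMk (hv.comp continuous_snd)).continuousOn fun p hp => ?_
  exact (N.iso _ p.1.2).symm.trans (congrArg Subtype.val hp)

end Topological

theorem isLocalHomeomorph_bundle {G : Type u} [GroupoidOps G] [TopologicalSpace G]
    [IsEtaleGroupoid G] (N : NormalAbelianSubgroupoid G) (hN : IsOpen N.carrier) :
    IsLocalHomeomorph N.bundle.π := by
  have h : range (r : G → G) = {u | r u = u} := by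
    ext u
    exact ⟨by rintro ⟨g, rfl⟩; exact IsGroupoid.r_r g, fun hu => ⟨u, hu⟩⟩
  exact ((Homeomorph.setCongr h).isLocalHomeomorph.comp
    IsEtaleGroupoid.isLocalHomeomorph_r).comp hN.isOpenEmbedding_subtypeVal.isLocalHomeomorph

/-! ### Conjugation of `S` -/

section Alg

variable {G : Type u} [GroupoidOps G] [IsGroupoid G] (N : NormalAbelianSubgroupoid G)

/-- Conjugation of `S` by an arrow depends only on the class of the arrow, because `S` is abelian. -/
theorem inv_mul_mul_eq_of_cls_eq {g h a : G} (ha : a ∈ N.carrier) (e : r a = r g)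
    (hgh : N.cls g = N.cls h) : h⁻¹ * a * h = g⁻¹ * a * g := by
  obtain ⟨b, hb, eb, rfl⟩ := N.exists_eq_mul_of_cls_eq hgh
  have ia := N.iso a ha
  have ib := N.iso b hb
  have hc := N.normal g a ha e (by rw [← ia, e])
  have e1 : s g⁻¹ = r a := by rw [s_inv, e]
  have e2 : s (g⁻¹ * a) = r g := by rw [s_mul _ _ e1, ← ia, e]
  have rc : r (g⁻¹ * a * g) = s g := by rw [r_mul _ _ e2, r_mul _ _ e1, r_inv]
  have sc : s (g⁻¹ * a * g) = s g := s_mul _ _ e2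
  have e3 : s b⁻¹ = r (g⁻¹ * a * g) := by rw [s_inv, rc, eb]
  have h1 : (g * b)⁻¹ * a * (g * b) = b⁻¹ * (g⁻¹ * a * g) * b := by
    rw [mul_inv_rev' eb, assoc _ _ _ (by rw [s_inv, r_inv, eb]) e1,
      ← assoc _ g b (by rw [s_mul _ _ (by rw [s_inv, r_mul _ _ e1, r_inv, eb]), e2]) eb,
      assoc b⁻¹ (g⁻¹ * a) g (by rw [s_inv, r_mul _ _ e1, r_inv, eb]) e2]
  rw [h1, assoc _ _ _ e3 (by rw [sc, eb]), N.comm _ hc b hb (by rw [rc, eb]),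
    inv_mul_cancel_left' (by rw [rc, ← ib, eb])]

theorem mul_mul_inv_eq_of_cls_eq {g h a : G} (ha : a ∈ N.carrier) (e : r a = s g)
    (hgh : N.cls g = N.cls h) : h * a * h⁻¹ = g * a * g⁻¹ := by
  have := N.inv_mul_mul_eq_of_cls_eq (g := g⁻¹) (h := h⁻¹) ha (by rw [r_inv, e])
    (by rw [← cls_inv, ← cls_inv, hgh])
  rwa [inv_inv', inv_inv'] at this

end Alg

section Topological

variable {G : Type u} [GroupoidOps G] [TopologicalSpace G] [IsTopologicalGroupoid G]
  (N : NormalAbelianSubgroupoid G)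

/-- The conjugate `g⁻¹ b g` as a point of the bundle `S`. -/
def invConj (g : G) (b : N.bundle.E) (e : r b.1 = r g) : N.bundle.E :=
  ⟨g⁻¹ * b.1 * g, N.normal g b.1 b.2 e (by rw [← N.iso _ b.2, e])⟩

theorem π_invConj (g : G) (b : N.bundle.E) (e : r b.1 = r g) :
    N.bundle.π (N.invConj g b e) = N.sX (N.cls g) := by
  refine Subtype.ext ?_
  have e1 : s g⁻¹ = r b.1 := by rw [s_inv, e]
  change r (g⁻¹ * b.1 * g) = s g
  rw [r_mul _ _ (by rw [s_mul _ _ e1, ← N.iso _ b.2, e]), r_mul _ _ e1, r_inv]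

/-! ### The action on characters and the groupoid `H` -/

theorem unitOf_injective : Function.Injective N.unitOf :=
  fun _ _ e => congrArg (fun z : N.H => z.1.2) e

theorem H_ext {h k : N.H} (h1 : h.1.1 = k.1.1) (h2 : h.1.2 = k.1.2) : h = k :=
  Subtype.ext (Prod.ext h1 h2)

theorem T_ext {t t' : N.T.E} (hb : N.T.π t = N.T.π t')
    (h : ∀ b, N.bundle.π b = N.T.π t → pairE t b = pairE t' b) : t = t' := dualE_ext hb h

theorem continuous_fst_H : Continuous fun h : N.H => h.1.1 :=
  continuous_fst.comp continuous_subtype_val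

theorem continuous_snd_H : Continuous fun h : N.H => h.1.2 :=
  continuous_snd.comp continuous_subtype_val

variable [T2Space G]

/-- The action `([g].x)(b) = x(g⁻¹ b g)`, for any representative `g` of the class. -/
theorem pairE_act {q : N.Q} (x : N.T.Fib (N.sX q)) {g : G} (hg : N.cls g = q) (b : N.bundle.E)
    (e : r b.1 = r g) : pairE (N.act q x).1 b = pairE x.1 (N.invConj g b e) := by
  subst hg
  have hb : N.bundle.π b = N.rX (N.cls g) := Subtype.ext e
  refine (pairE_fib (N.act _ x) ⟨b, hb⟩).trans ?_
  refine (pair_pull (B := N.bundle) _ x ⟨b, hb⟩).trans ?_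
  rw [← pairE_fib]
  congr 1
  refine Subtype.ext ?_
  change (N.rep (N.cls g))⁻¹ * b.1 * (N.rep (N.cls g))⁻¹⁻¹ = g⁻¹ * b.1 * g
  rw [inv_inv']
  exact N.inv_mul_mul_eq_of_cls_eq b.2 e (N.cls_rep _).symm

/-- The range of an arrow of `H`, as a point of `Ŝ`. -/
noncomputable def H.tgt {N : NormalAbelianSubgroupoid G} (h : N.H) : N.T.E := (N.act h.1.1 h.pt).1

theorem base_tgt (h : N.H) : N.T.π h.tgt = N.rX h.1.1 := (N.act h.1.1 h.pt).2

theorem pairE_tgt (h : N.H) {g : G} (hg : N.cls g = h.1.1) (b : N.bundle.E) (e : r b.1 = r g) :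
    pairE h.tgt b = pairE h.1.2 (N.invConj g b e) := N.pairE_act h.pt hg b e

theorem r_H (h : N.H) : r h = N.unitOf h.tgt := rfl

theorem s_H (h : N.H) : s h = N.unitOf h.1.2 := rfl

theorem mul_H {h k : N.H} (e : s h = r k) :
    h * k = N.arrow (h.1.1 * k.1.1) (reb (N.sX_mul (N.sX_eq_of_comp e)).symm k.pt) :=
  dif_pos e

theorem fst_mul_H {h k : N.H} (e : s h = r k) : (h * k).1.1 = h.1.1 * k.1.1 := by
  rw [mul_H N e]
  rfl

theorem snd_mul_H {h k : N.H} (e : s h = r k) : (h * k).1.2 = k.1.2 := by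
  rw [mul_H N e]
  rfl

theorem fst_inv_H (h : N.H) : h⁻¹.1.1 = h.1.1⁻¹ := rfl

theorem snd_inv_H (h : N.H) : h⁻¹.1.2 = h.tgt := rfl

theorem tgt_unitOf (x : N.T.E) : (N.unitOf x).tgt = x := by
  have hb : N.T.π (N.unitOf x).tgt = N.T.π x := (N.base_tgt _).trans (N.rX_unit _)
  refine N.T_ext hb fun b hbx => ?_
  have e : r b.1 = (N.T.π x).1 := congrArg Subtype.val (hbx.trans hb)
  rw [N.pairE_tgt _ rfl b (e.trans (N.T.π x).2.symm)]
  change pairE x _ = _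
  congr 1
  refine Subtype.ext ?_
  change (N.T.π x).1⁻¹ * b.1 * (N.T.π x).1 = b.1
  rw [← e, inv_r, r_mul_self, N.iso _ b.2, mul_s_self]

theorem sX_fst_eq_rX_fst {h k : N.H} (e : s h = r k) : N.sX h.1.1 = N.rX k.1.1 :=
  N.sX_eq_of_comp e

/-- In a product `hk` the range is that of `h`, since `[g].([g'].x) = [gg'].x`. -/
theorem tgt_mul {h k : N.H} (e : s h = r k) : (h * k).tgt = h.tgt := by
  have e1 := N.sX_fst_eq_rX_fst e
  have e2 : h.1.2 = k.tgt := N.unitOf_injective e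
  obtain ⟨g, hg⟩ : ∃ g, N.cls g = h.1.1 := ⟨_, N.cls_rep _⟩
  obtain ⟨g', hg'⟩ : ∃ g', N.cls g' = k.1.1 := ⟨_, N.cls_rep _⟩
  have egg : s g = r g' := by
    rw [← hg, ← hg'] at e1
    exact congrArg Subtype.val e1
  have hgg : N.cls (g * g') = (h * k).1.1 := by rw [N.fst_mul_H e, ← N.cls_mul egg, hg, hg']
  have hb : N.T.π (h * k).tgt = N.T.π h.tgt := by
    rw [base_tgt, base_tgt, N.fst_mul_H e, N.rX_mul e1]
  refine N.T_ext hb fun b hbx => ?_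
  have er : r b.1 = r g := by
    rw [hb, base_tgt, ← hg] at hbx
    exact congrArg Subtype.val hbx
  have es : s b.1 = r g := by rw [← N.iso _ b.2, er]
  have e3 : s g⁻¹ = r b.1 := by rw [s_inv, er]
  have e4 : s (g⁻¹ * b.1) = r g := by rw [s_mul _ _ e3, es]
  have e5 : r (g⁻¹ * b.1 * g) = r g' := by rw [r_mul _ _ e4, r_mul _ _ e3, r_inv, egg]
  rw [N.pairE_tgt _ hgg b (by rw [r_mul _ _ egg, er]), N.pairE_tgt _ hg b er, e2,
    N.pairE_tgt k hg' _ e5, N.snd_mul_H e]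
  congr 1
  refine Subtype.ext ?_
  change (g * g')⁻¹ * b.1 * (g * g') = g'⁻¹ * (g⁻¹ * b.1 * g) * g'
  have e6 : s g'⁻¹ = r g⁻¹ := by rw [s_inv, r_inv, egg]
  rw [mul_inv_rev' egg, assoc _ _ _ e6 e3,
    ← assoc _ g g' (by rw [s_mul _ _ (by rw [r_mul _ _ e3, e6]), e4]) egg,
    assoc g'⁻¹ (g⁻¹ * b.1) g (by rw [r_mul _ _ e3, e6]) e4]

theorem tgt_inv (h : N.H) : h⁻¹.tgt = h.1.2 := by
  obtain ⟨g, hg⟩ : ∃ g, N.cls g = h.1.1 := ⟨_, N.cls_rep _⟩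
  have hb : N.T.π h⁻¹.tgt = N.T.π h.1.2 := by rw [base_tgt, fst_inv_H, rX_inv, h.2]
  refine N.T_ext hb fun b hbx => ?_
  have er : r b.1 = s g := by
    rw [hb, h.2, ← hg] at hbx
    exact congrArg Subtype.val hbx
  have es : s b.1 = s g := by rw [← N.iso _ b.2, er]
  have hg' : N.cls g⁻¹ = h⁻¹.1.1 := by rw [fst_inv_H, ← hg, cls_inv]
  have e1 : s g⁻¹⁻¹ = r b.1 := by rw [inv_inv', er]
  have e2 : s (g⁻¹⁻¹ * b.1) = r g⁻¹ := by rw [s_mul _ _ e1, es, r_inv]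
  rw [N.pairE_tgt _ hg' b (by rw [r_inv, er]), snd_inv_H,
    N.pairE_tgt h hg _ ((r_mul _ _ e2).trans (by rw [r_mul _ _ e1, inv_inv']))]
  congr 1
  refine Subtype.ext ?_
  change g⁻¹ * (g⁻¹⁻¹ * b.1 * g⁻¹) * g = b.1
  rw [inv_inv'] at e1 e2 ⊢
  rw [← assoc g⁻¹ _ _ (by rw [s_inv, r_mul _ _ e1]) e2, inv_mul_cancel_left' e1,
    assoc _ _ _ (by rw [es, r_inv]) (s_inv g), inv_mul_self, ← es, mul_s_self]

theorem isGroupoid_H : IsGroupoid N.H := by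
  have hQ := N.isGroupoid_Q
  have hu : ∀ x : N.T.E, (N.unitOf x).1.1 = N.cls (N.T.π x).1 := fun _ => rfl
  have hcl : ∀ h : N.H, N.cls (N.T.π h.tgt).1 = r h.1.1 := fun h => by rw [base_tgt]; rfl
  have hcl' : ∀ h : N.H, N.cls (N.T.π h.1.2).1 = s h.1.1 := fun h => by rw [h.2]; rfl
  have hc : ∀ {h k : N.H}, s h = r k → s h.1.1 = r k.1.1 := fun {h k} e => by
    rw [← hcl, ← hcl']
    exact congrArg (fun z : N.H => z.1.1) e
  have r_mul' : ∀ h k : N.H, s h = r k → r (h * k) = r h := fun h k e => by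
    rw [r_H, r_H, N.tgt_mul e]
  have s_mul' : ∀ h k : N.H, s h = r k → s (h * k) = s k := fun h k e => by
    rw [s_H, s_H, N.snd_mul_H e]
  have r_unit : ∀ x : N.T.E, r (N.unitOf x) = N.unitOf x := fun x => by rw [r_H, tgt_unitOf]
  have s_unit : ∀ x : N.T.E, s (N.unitOf x) = N.unitOf x := fun x => rfl
  have r_inv' : ∀ h : N.H, r h⁻¹ = s h := fun h => by rw [r_H, tgt_inv, s_H]
  refine
    { r_r := fun h => r_unit _
      s_r := fun h => s_unit _
      r_s := fun h => r_unit _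
      s_s := fun h => s_unit _
      r_mul := r_mul'
      s_mul := s_mul'
      assoc := fun h k l e e' => ?_
      r_mul_self := fun h => ?_
      mul_s_self := fun h => ?_
      r_inv := r_inv'
      s_inv := fun h => rfl
      mul_inv_self := fun h => ?_
      inv_mul_self := fun h => ?_ }
  · have e1 : s (h * k) = r l := by rw [s_mul' _ _ e, e']
    have e2 : s h = r (k * l) := by rw [r_mul' _ _ e', e]
    refine N.H_ext ?_ ?_
    · rw [N.fst_mul_H e1, N.fst_mul_H e2, N.fst_mul_H e, N.fst_mul_H e',
        hQ.assoc _ _ _ (hc e) (hc e')]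
    · rw [N.snd_mul_H e1, N.snd_mul_H e2, N.snd_mul_H e']
  · have e : s (r h) = r h := s_unit _
    refine N.H_ext ?_ (N.snd_mul_H e)
    rw [N.fst_mul_H e, r_H, hu, hcl, hQ.r_mul_self]
  · have e : s h = r (s h) := (r_unit _).symm
    refine N.H_ext ?_ (N.snd_mul_H e)
    rw [N.fst_mul_H e, s_H, hu, hcl', hQ.mul_s_self]
  · have e : s h = r h⁻¹ := (r_inv' h).symm
    refine N.H_ext ?_ ?_
    · rw [N.fst_mul_H e, fst_inv_H, r_H, hu, hcl, hQ.mul_inv_self]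
    · rw [N.snd_mul_H e, snd_inv_H]
      rfl
  · have e : s h⁻¹ = r h := rfl
    refine N.H_ext ?_ ?_
    · rw [N.fst_mul_H e, fst_inv_H, s_H, hu, hcl', hQ.inv_mul_self]
    · rw [N.snd_mul_H e]
      rfl

/-- The action on `Ŝ` is continuous: its evaluations are those of the argument at conjugates by the
values of the section. -/
theorem continuous_tgt [LocallyCompactSpace G] (hN : IsClosed N.carrier) {σ : N.Q → G}
    (hσ : N.IsUnitalSection σ) : Continuous fun h : N.H => h.tgt := by
  have := N.locallyCompactSpace_bundle hN
  refine continuous_dualE_of_continuousOn ((N.continuous_rX.comp N.continuous_fst_H).congr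
    fun h => (N.base_tgt h).symm) ?_
  rw [continuousOn_iff_continuous_domRestrict]
  let D := ↥{p : N.H × N.bundle.E | N.bundle.π p.2 = (H.tgt p.1 : N.bundle.DualE).base}
  have hσ' : Continuous fun p : D => σ p.1.1.1.1 :=
    hσ.continuous.comp (N.continuous_fst_H.comp (continuous_fst.comp continuous_subtype_val))
  have hb : Continuous fun p : D => p.1.2.1 :=
    continuous_subtype_val.comp (continuous_snd.comp continuous_subtype_val)
  have er : ∀ p : D, r p.1.2.1 = r (σ p.1.1.1.1) := fun p => by
    rw [hσ.r_apply, ← base_tgt]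
    exact congrArg Subtype.val p.2
  have e1 : ∀ p : D, s (σ p.1.1.1.1)⁻¹ = r p.1.2.1 := fun p => by rw [s_inv, er]
  have hk : Continuous fun p : D => N.invConj (σ p.1.1.1.1) p.1.2 (er p) :=
    (((IsTopologicalGroupoid.continuous_inv.comp hσ').groupoid_mul hb e1).groupoid_mul hσ'
      fun p => by
        change s ((σ p.1.1.1.1)⁻¹ * p.1.2.1) = _
        rw [s_mul _ _ (e1 p), ← N.iso _ p.1.2.2, er]).subtype_mk _
  have hx : Continuous fun p : D => p.1.1.1.2 :=
    N.continuous_snd_H.comp (continuous_fst.comp continuous_subtype_val)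
  have h := continuousOn_univ.1 (continuousOn_pairE_comp (B := N.bundle)
    hx.continuousOn hk.continuousOn (D := univ) fun p _ => by
      rw [π_invConj, hσ.cls_apply]
      exact p.1.1.2.symm)
  exact h.congr fun p => (N.pairE_tgt p.1.1 (hσ.cls_apply _) _ (er p)).symm

theorem isTopologicalGroupoid_H [LocallyCompactSpace G] (hN : IsClosed N.carrier) {σ : N.Q → G}
    (hσ : N.IsUnitalSection σ) : IsTopologicalGroupoid N.H where
  toIsGroupoid := N.isGroupoid_H
  continuousOn_mul := by
    have hQ := N.isTopologicalGroupoid_Q hσ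
    refine IsInducing.subtypeVal.continuousOn_iff.2 ?_
    refine ContinuousOn.congr (f := fun p : N.H × N.H => (p.1.1.1 * p.2.1.1, p.2.1.2)) ?_
      fun p hp => Prod.ext (N.fst_mul_H hp) (N.snd_mul_H hp)
    refine ContinuousOn.prodMk ?_ (N.continuous_snd_H.comp continuous_snd).continuousOn
    refine hQ.continuousOn_mul.comp (f := fun p : N.H × N.H => (p.1.1.1, p.2.1.1))
      ((N.continuous_fst_H.comp continuous_fst).prodMk
        (N.continuous_fst_H.comp continuous_snd)).continuousOn fun p hp => ?_
    change N.cls _ = N.cls _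
    rw [N.sX_fst_eq_rX_fst hp]
  continuous_inv := by
    have hQ := N.isTopologicalGroupoid_Q hσ
    exact ((hQ.continuous_inv.comp N.continuous_fst_H).prodMk
      (N.continuous_tgt hN hσ)).subtype_mk _

end Topological

section HT

variable {G : Type u} [GroupoidOps G] [TopologicalSpace G] [IsTopologicalGroupoid G]
  (N : NormalAbelianSubgroupoid G)

/-! ### The bundle `S` and the section -/

theorem apply_eq_of_cls_eq {Γ : Type v} [AddCommGroup Γ] [TopologicalSpace Γ] {c : G → Γ}
    (hc : IsCocycle c) (hN : ∀ a ∈ N.carrier, c a = 0) {g h : G} (e : N.cls g = N.cls h) :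
    c g = c h := by
  obtain ⟨a, ha, ea, rfl⟩ := N.exists_eq_mul_of_cls_eq e
  rw [hc.map_mul _ _ ea, hN a ha, add_zero]

theorem r_fib {x : Obj G} (t : N.bundle.Fib x) : r t.1.1 = x.1 := congrArg Subtype.val t.2

theorem s_fib {x : Obj G} (t : N.bundle.Fib x) : s t.1.1 = x.1 := by
  rw [← N.iso _ t.1.2, r_fib]

variable {N}

theorem π_homeomorph_symm (hev : IsHomeomorph (evE : N.bundle.E → N.That.E)) (χ : N.That.E) :
    N.bundle.π ((hev.homeomorph _).symm χ) = N.That.π χ :=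
  congrArg N.That.π ((hev.homeomorph _).apply_symm_apply χ)

theorem s_section_cls_inv {σ : N.Q → G} (hσ : N.IsUnitalSection σ) (g : G) :
    s (σ (N.cls g))⁻¹ = r g := by
  rw [s_inv, hσ.r_apply]
  rfl

theorem section_cls_inv_mul_mem {σ : N.Q → G} (hσ : N.IsUnitalSection σ) (g : G) :
    (σ (N.cls g))⁻¹ * g ∈ N.carrier := by
  obtain ⟨a, ha, ea, h⟩ := N.exists_eq_mul_of_cls_eq (hσ.cls_apply (N.cls g))
  rw [← inv_mul_cancel_left' ea, ← h] at ha
  exact ha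

/-- The element `𝔰([g])⁻¹ g` as a point of the bundle `S`. -/
def sectionDiff {σ : N.Q → G} (hσ : N.IsUnitalSection σ) (g : G) : N.bundle.E :=
  ⟨(σ (N.cls g))⁻¹ * g, section_cls_inv_mul_mem hσ g⟩

theorem π_sectionDiff {σ : N.Q → G} (hσ : N.IsUnitalSection σ) (g : G) :
    N.bundle.π (sectionDiff hσ g) = N.sX (N.cls g) := by
  refine Subtype.ext ?_
  change r ((σ (N.cls g))⁻¹ * g) = s g
  rw [r_mul _ _ (s_section_cls_inv hσ g), r_inv, hσ.s_apply]
  rfl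

theorem continuous_sectionDiff {σ : N.Q → G} (hσ : N.IsUnitalSection σ) :
    Continuous (sectionDiff hσ) :=
  ((IsTopologicalGroupoid.continuous_inv.comp
    (hσ.continuous.comp N.continuous_cls)).groupoid_mul continuous_id
      (s_section_cls_inv hσ)).subtype_mk _

variable (N) [T2Space G]

/-! ### The quotient `H/T` -/

theorem continuous_toQ : Continuous N.toQ := N.continuous_fst_H.quotient_lift _

/-- The product of `H/T` is computed on composable representatives: the representative of the left
factor can be moved within its orbit so that its source is the range of a given right factor. -/
theorem exists_comp_reps {a b : N.HT} (e : s a = r b) :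
    ∃ p : N.H × N.H, N.cl p.1 = a ∧ N.cl p.2 = b ∧ s p.1 = r p.2 := by
  have hx := N.comp_toQ e
  obtain ⟨h, rfl⟩ : ∃ h, N.cl h = a := Quotient.exists_rep a
  obtain ⟨k, rfl⟩ : ∃ k, N.cl k = b := Quotient.exists_rep b
  exact ⟨(N.arrow h.1.1 (reb hx.symm (N.act k.1.1 k.pt)), k), N.toQ_injective rfl, rfl, rfl⟩

theorem toQ_mul {a b : N.HT} (e : s a = r b) : N.toQ (a * b) = N.toQ a * N.toQ b := by
  have h := N.exists_comp_reps e
  obtain ⟨h1, h2, h3⟩ := h.choose_spec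
  have h4 : a * b = N.cl (h.choose.1 * h.choose.2) := dif_pos h
  rw [h4]
  refine (N.fst_mul_H h3).trans ?_
  exact congrArg₂ (fun x y => N.toQ x * N.toQ y) h1 h2

theorem isGroupoidHom_cl : IsGroupoidHom N.cl := by
  have hc : ∀ h k : N.H, s h = r k → s (N.cl h) = r (N.cl k) := fun h k e => congrArg N.cl e
  refine ⟨hc, fun h k e => N.toQ_injective ?_⟩
  rw [N.toQ_mul (hc h k e)]
  exact N.fst_mul_H e

theorem continuous_one_T : Continuous fun q : N.Q => (1 : N.T.Fib (N.sX q)).1 := by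
  refine continuous_dualE_of_continuousOn (B := N.bundle) N.continuous_sX ?_
  refine (continuousOn_const (c := (1 : Circle))).congr fun p hp => ?_
  exact (pairE_fib (1 : N.T.Fib (N.sX p.1)) ⟨p.2, hp⟩).trans (pair_one_left _)

/-- The canonical homeomorphism `H/T → G/S`; its inverse comes from the unit section of `T`. -/
noncomputable def homeomorphQ : N.HT ≃ₜ N.Q where
  toFun := N.toQ
  invFun q := N.cl (N.arrow q 1)
  left_inv _ := N.toQ_injective rfl
  right_inv _ := rfl
  continuous_toFun := N.continuous_toQ
  continuous_invFun :=
    continuous_quotient_mk'.comp ((continuous_id.prodMk N.continuous_one_T).subtype_mk _)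

theorem isTopGroupoidIso_homeomorphQ : IsTopGroupoidIso N.homeomorphQ :=
  isTopGroupoidIso_of_homeomorph _ N.toQ_r N.toQ_s fun _ _ e => N.toQ_mul e

theorem isTopologicalGroupoid_HT {σ : N.Q → G} (hσ : N.IsUnitalSection σ) :
    IsTopologicalGroupoid N.HT :=
  have := N.isTopologicalGroupoid_Q hσ
  .of_homeomorph N.homeomorphQ N.toQ_r N.toQ_s N.toQ_inv fun _ _ e => N.toQ_mul e

/-! ### The cocycle on `H` -/

theorem isCocycle_H {Γ : Type v} [AddCommGroup Γ] [TopologicalSpace Γ] {c : G → Γ}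
    (hc : IsCocycle c) (hN : ∀ a ∈ N.carrier, c a = 0) {σ : N.Q → G} (hσ : N.IsUnitalSection σ) :
    IsCocycle fun h : N.H => c (σ h.1.1) where
  continuous := hc.continuous.comp (hσ.continuous.comp N.continuous_fst_H)
  map_mul h k e := by
    have e1 : s (σ h.1.1) = r (σ k.1.1) := by
      rw [hσ.s_apply, hσ.r_apply, N.sX_fst_eq_rX_fst e]
    rw [← hc.map_mul _ _ e1]
    refine N.apply_eq_of_cls_eq hc hN ?_
    rw [hσ.cls_apply, N.fst_mul_H e, ← N.cls_mul e1, hσ.cls_apply, hσ.cls_apply]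

/-! ### Evaluations in the bidual -/

theorem dia_ev (a : N.HT) (t : N.bundle.Fib (N.sX (N.toQ a))) :
    N.dia a (ev t) = ev (N.conj (N.rep (N.toQ a)) (N.sX_rep _).symm (N.rX_rep _).symm t) :=
  dual_fib_ext fun _ => rfl

/-- Under the identification of `T̂` with `S`, the action of an inverse on `T̂` is the conjugation
`t ↦ g⁻¹ t g`. -/
theorem exists_diaInv_ev (b : N.HT) (t : N.bundle.Fib (N.rX (N.toQ b))) {g : G}
    (hg : N.cls g = N.toQ b) :
    ∃ t' : N.bundle.Fib (N.sX (N.toQ b)), N.diaInv b (ev t) = ev t' ∧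
      t'.1.1 = g⁻¹ * t.1.1 * g := by
  refine ⟨_, by rw [diaInv, reb_ev, dia_ev, reb_ev], ?_⟩
  have hg' : N.cls g⁻¹ = N.toQ b⁻¹ := by rw [toQ_inv, ← hg, cls_inv]
  have ht : r t.1.1 = r g := (N.r_fib t).trans (by rw [← hg]; rfl)
  change N.rep (N.toQ b⁻¹) * t.1.1 * (N.rep (N.toQ b⁻¹))⁻¹ = _
  rw [N.mul_mul_inv_eq_of_cls_eq (g := g⁻¹) t.1.2 (by rw [s_inv, ht])
    (hg'.trans (N.cls_rep _).symm), inv_inv']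

/-- Under the identification of `T̂` with `S`, the action on `T̂` is the conjugation
`t ↦ g t g⁻¹`. -/
theorem exists_dia_ev (a : N.HT) (t : N.bundle.Fib (N.sX (N.toQ a))) {g : G}
    (hg : N.cls g = N.toQ a) :
    ∃ t' : N.bundle.Fib (N.rX (N.toQ a)), N.dia a (ev t) = ev t' ∧
      t'.1.1 = g * t.1.1 * g⁻¹ := by
  refine ⟨_, N.dia_ev a t, ?_⟩
  have ht : r t.1.1 = s g := (N.r_fib t).trans (by rw [← hg]; rfl)
  exact N.mul_mul_inv_eq_of_cls_eq t.1.2 ht (hg.trans (N.cls_rep _).symm)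

/-! ### The twisting cocycle -/

variable {N}

theorem continuous_theta [LocallyCompactSpace G] (hN : IsClosed N.carrier) {σ : N.Q → G}
    (hσ : N.IsUnitalSection σ) :
    Continuous (fun p : {p : N.HT × N.HT // s p.1 = r p.2} => (theta hσ p.1.1 p.1.2 p.2).1) := by
  have := N.locallyCompactSpace_bundle hN
  have hQ := N.isTopologicalGroupoid_Q hσ
  let D := {p : N.HT × N.HT // s p.1 = r p.2}
  have h1 : Continuous fun p : D => N.toQ p.1.1 :=
    N.continuous_toQ.comp (continuous_fst.comp continuous_subtype_val)
  have h2 : Continuous fun p : D => N.toQ p.1.2 :=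
    N.continuous_toQ.comp (continuous_snd.comp continuous_subtype_val)
  have hc : ∀ p : D, N.sX (N.toQ p.1.1) = N.rX (N.toQ p.1.2) := fun p => N.comp_toQ p.2
  have h3 : Continuous fun p : D => N.toQ p.1.1 * N.toQ p.1.2 :=
    h1.groupoid_mul h2 fun p => congrArg (fun x : Obj G => N.cls x.1) (hc p)
  have e1 : ∀ p : D, s (σ (N.toQ p.1.1 * N.toQ p.1.2))⁻¹ = r (σ (N.toQ p.1.1)) := fun p => by
    rw [s_inv, hσ.r_apply, hσ.r_apply, N.rX_mul (hc p)]
  have e2 : ∀ p : D, s (σ (N.toQ p.1.1)) = r (σ (N.toQ p.1.2)) := fun p => by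
    rw [hσ.s_apply, hσ.r_apply, hc]
  have h4 : Continuous fun p : D => (σ (N.toQ p.1.1 * N.toQ p.1.2))⁻¹ * σ (N.toQ p.1.1) *
      σ (N.toQ p.1.2) :=
    ((IsTopologicalGroupoid.continuous_inv.comp (hσ.continuous.comp h3)).groupoid_mul
      (hσ.continuous.comp h1) e1).groupoid_mul (hσ.continuous.comp h2) fun p => by
        change s ((σ (N.toQ p.1.1 * N.toQ p.1.2))⁻¹ * σ (N.toQ p.1.1)) = _
        exact (s_mul _ _ (e1 p)).trans (e2 p)
  have h5 : Continuous fun p : D => (sectionDefect hσ _ _ (hc p)).1 := h4.subtype_mk _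
  exact (continuous_evE (B := N.bundle)).comp h5 |>.congr fun p => evE_val _

theorem theta_normalized {σ : N.Q → G} (hσ : N.IsUnitalSection σ) (a : N.HT)
    (e : s (r a) = r a) : theta hσ (r a) a e = 1 := by
  have hQ := N.isGroupoid_Q
  refine Eq.trans (congrArg ev (Subtype.ext (Subtype.ext ?_))) ev_one
  have h1 : N.toQ (r a) * N.toQ a = N.toQ a := by rw [toQ_r]; exact r_mul_self (N.toQ a)
  have h2 : σ (N.toQ (r a)) = r (σ (N.toQ a)) := by
    rw [toQ_r, hσ.unital _ (N.rX _).2, hσ.r_apply]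
  change (σ (N.toQ (r a) * N.toQ a))⁻¹ * σ (N.toQ (r a)) * σ (N.toQ a) = (N.sX (N.toQ a)).1
  rw [h1, h2, ← s_inv, mul_s_self, inv_mul_self, hσ.s_apply]

/-- The cocycle identity of the section defect, with `p = 𝔰(ab)`, `w = 𝔰(bc)` and `q = 𝔰(abc)`. -/
theorem sectionDefect_identity {G : Type*} [GroupoidOps G] [IsGroupoid G] {p a b c q w : G}
    (hab : s a = r b) (hbc : s b = r c) (hp : r p = r a) (hp' : s p = r c) (hq : r q = r a)
    (hw : r w = r b) (hw' : s w = s c) :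
    (q⁻¹ * p * c) * (c⁻¹ * (p⁻¹ * a * b) * c) = q⁻¹ * a * w * (w⁻¹ * b * c) := by
  simp (maxDischargeDepth := 8) only [assoc, s_mul, r_mul, s_inv, r_inv, mul_inv_cancel_left',
    hab, hbc, hp, hp', hq, hw, hw']

theorem theta_cocycle {σ : N.Q → G} (hσ : N.IsUnitalSection σ) (a b c : N.HT) (hab : s a = r b)
    (hbc : s b = r c) (h1 : s (a * b) = r c) (h2 : s a = r (b * c)) :
    N.diaInv c (reb (N.comp_toQ hbc) (theta hσ a b hab)) * theta hσ (a * b) c h1 =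
      reb (N.sX_toQ_mul b c) (theta hσ a (b * c) h2) * theta hσ b c hbc := by
  have hQ := N.isGroupoid_Q
  have eab := N.comp_toQ hab
  have ebc := N.comp_toQ hbc
  have eab' : s (N.toQ a) = r (N.toQ b) := congrArg (fun x : Obj G => N.cls x.1) eab
  have ebc' : s (N.toQ b) = r (N.toQ c) := congrArg (fun x : Obj G => N.cls x.1) ebc
  simp only [theta, reb_ev]
  obtain ⟨t, ht, ht'⟩ := N.exists_diaInv_ev c (reb (N.comp_toQ hbc)
    (sectionDefect hσ (N.toQ a) (N.toQ b) (N.comp_toQ hab))) (hσ.cls_apply (N.toQ c))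
  rw [ht, ← ev_mul, ← ev_mul, mul_comm t]
  refine congrArg ev (Subtype.ext (Subtype.ext ?_))
  change (σ (N.toQ (a * b) * N.toQ c))⁻¹ * σ (N.toQ (a * b)) * σ (N.toQ c) * t.1.1 =
    (σ (N.toQ a * N.toQ (b * c)))⁻¹ * σ (N.toQ a) * σ (N.toQ (b * c)) *
      ((σ (N.toQ b * N.toQ c))⁻¹ * σ (N.toQ b) * σ (N.toQ c))
  rw [ht', N.toQ_mul hab, N.toQ_mul hbc, hQ.assoc _ _ _ eab' ebc']
  have e3 : N.sX (N.toQ a) = N.rX (N.toQ b * N.toQ c) := by rw [N.rX_mul ebc, eab]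
  refine sectionDefect_identity ?_ ?_ ?_ ?_ ?_ ?_ ?_
  · rw [hσ.s_apply, hσ.r_apply, eab]
  · rw [hσ.s_apply, hσ.r_apply, ebc]
  · rw [hσ.r_apply, hσ.r_apply, N.rX_mul eab]
  · rw [hσ.s_apply, hσ.r_apply, N.sX_mul eab, ebc]
  · rw [hσ.r_apply, hσ.r_apply, N.rX_mul e3]
  · rw [hσ.r_apply, hσ.r_apply, N.rX_mul ebc]
  · rw [hσ.s_apply, hσ.s_apply, N.sX_mul ebc]

theorem isTwistingCocycle_theta [LocallyCompactSpace G] (hN : IsClosed N.carrier) {σ : N.Q → G}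
    (hσ : N.IsUnitalSection σ) : N.IsTwistingCocycle (theta hσ) :=
  ⟨continuous_theta hN hσ, theta_normalized hσ, theta_cocycle hσ⟩

/-! ### The isomorphism `H/T ⊠ T̂ ≅ G` -/

theorem s_section_eq_r_symm (hev : IsHomeomorph (evE : N.bundle.E → N.That.E)) {σ : N.Q → G}
    (hσ : N.IsUnitalSection σ) {θ : N.Twist} (z : Box θ) :
    s (σ (N.toQ z.1.1)) = r ((hev.homeomorph _).symm z.1.2).1 := by
  rw [hσ.s_apply, ← z.2, ← π_homeomorph_symm hev]
  rfl

/-- The map `([g], t) ↦ 𝔰([g]) t`, with inverse `g ↦ ([g], 𝔰([g])⁻¹ g)`, for the identification of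
`T̂` with `S` by evaluation. -/
noncomputable def boxHomeomorph (hev : IsHomeomorph (evE : N.bundle.E → N.That.E)) {σ : N.Q → G}
    (hσ : N.IsUnitalSection σ) (θ : N.Twist) : Box θ ≃ₜ G where
  toFun z := σ (N.toQ z.1.1) * ((hev.homeomorph _).symm z.1.2).1
  invFun g := ⟨(N.homeomorphQ.symm (N.cls g), evE (sectionDiff hσ g)), π_sectionDiff hσ g⟩
  left_inv z := by
    have hc := s_section_eq_r_symm hev hσ z
    have h : N.cls (σ (N.toQ z.1.1) * ((hev.homeomorph _).symm z.1.2).1) = N.toQ z.1.1 := by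
      rw [N.cls_mul_carrier ((hev.homeomorph _).symm z.1.2).2 hc, hσ.cls_apply]
    refine Subtype.ext (Prod.ext (N.toQ_injective h) ?_)
    refine ((hev.homeomorph _).symm_apply_eq.1 (Subtype.ext ?_)).symm
    change _ = (σ (N.cls (σ (N.toQ z.1.1) * _)))⁻¹ * (σ (N.toQ z.1.1) * _)
    rw [h, inv_mul_cancel_left' hc]
  right_inv g :=
    (congrArg₂ (· * ·) rfl (congrArg Subtype.val
      ((hev.homeomorph _).symm_apply_apply (sectionDiff hσ g)))).trans
        (mul_inv_cancel_left' (by rw [hσ.r_apply]; rfl))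
  continuous_toFun :=
    (hσ.continuous.comp (N.continuous_toQ.comp
      (continuous_fst.comp continuous_subtype_val))).groupoid_mul
      (continuous_subtype_val.comp ((hev.homeomorph _).symm.continuous.comp
        (continuous_snd.comp continuous_subtype_val))) fun z : Box θ => s_section_eq_r_symm hev hσ z
  continuous_invFun :=
    ((N.homeomorphQ.symm.continuous.comp N.continuous_cls).prodMk
      (hev.continuous.comp (continuous_sectionDiff hσ))).subtype_mk _

variable (hev : IsHomeomorph (evE : N.bundle.E → N.That.E)) {σ : N.Q → G}
  (hσ : N.IsUnitalSection σ)

theorem boxHomeomorph_box (θ : N.Twist) (a : N.HT) (t : N.bundle.Fib (N.sX (N.toQ a))) :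
    boxHomeomorph hev hσ θ (box θ a (ev t)) = σ (N.toQ a) * t.1.1 := by
  change σ (N.toQ a) * ((hev.homeomorph _).symm (ev t).1).1 = σ (N.toQ a) * t.1.1
  rw [((hev.homeomorph _).symm_apply_eq.2 (evE_val t).symm :
    (hev.homeomorph _).symm (ev t).1 = t.1)]

include hev in
theorem exists_box_eq {θ : N.Twist} (z : Box θ) :
    ∃ (a : N.HT) (t : N.bundle.Fib (N.sX (N.toQ a))), box θ a (ev t) = z := by
  obtain ⟨t, ht⟩ := hev.surjective z.1.2
  have hx : N.bundle.π t = N.sX (N.toQ z.1.1) := (congrArg N.That.π ht).trans z.2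
  exact ⟨z.1.1, ⟨t, hx⟩, Subtype.ext (Prod.ext rfl ((evE_val (⟨t, hx⟩ : N.bundle.Fib _)).symm.trans
    ht))⟩

theorem box_mul {θ : N.Twist} {a b : N.HT} (χ : N.That.Fib (N.sX (N.toQ a)))
    (ν : N.That.Fib (N.sX (N.toQ b))) (e : s a = r b) :
    box θ a χ * box θ b ν = box θ (a * b) (reb (N.sX_toQ_mul _ _).symm
      (θ a b e * N.diaInv b (reb (N.comp_toQ e) χ) * ν)) := dif_pos e

/-- Multiplicativity of `([g], t) ↦ 𝔰([g]) t`, with `p = 𝔰(ab)`. -/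
theorem section_mul_identity {G : Type*} [GroupoidOps G] [IsGroupoid G] {p a b t u : G}
    (hab : s a = r b) (hp : r p = r a) (ht : r t = r b) (ht' : s t = r b) (hu : r u = s b) :
    p * (p⁻¹ * a * b * (b⁻¹ * t * b) * u) = a * t * (b * u) := by
  simp (maxDischargeDepth := 8) only [assoc, s_mul, r_mul, s_inv, r_inv, mul_inv_cancel_left',
    hab, hp, ht, ht', hu]

/-- Compatibility of `([g], t) ↦ 𝔰([g]) t` with inverses, with `m = 𝔰(a⁻¹)`. -/
theorem section_inv_identity {G : Type*} [GroupoidOps G] [IsGroupoid G] {a m t : G}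
    (hab : s a = r m) (ht : r t = r m) (ht' : s t = r m) :
    m * ((a * m)⁻¹ * (a * t⁻¹ * a⁻¹)) = (a * t)⁻¹ := by
  simp (maxDischargeDepth := 8) only [mul_inv_rev', assoc, r_mul, s_inv, r_inv,
    inv_mul_cancel_left', mul_inv_cancel_left', hab, ht, ht']

theorem boxHomeomorph_r (z : Box (theta hσ)) :
    boxHomeomorph hev hσ _ (r z) = r (boxHomeomorph hev hσ _ z) := by
  obtain ⟨a, t, rfl⟩ := exists_box_eq hev z
  have h1 : (r (box (theta hσ) a (ev t)) : Box (theta hσ)) = box _ (r a) (ev 1) := by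
    rw [ev_one]; rfl
  rw [h1, boxHomeomorph_box, boxHomeomorph_box,
    r_mul _ _ (by rw [hσ.s_apply, N.r_fib]), hσ.r_apply]
  change σ (N.toQ (r a)) * (N.sX (N.toQ (r a))).1 = _
  rw [toQ_r, hσ.unital _ (N.rX _).2, sX_unit]
  exact r_mul_of_eq (N.rX (N.toQ a)).2.symm

theorem boxHomeomorph_s (z : Box (theta hσ)) :
    boxHomeomorph hev hσ _ (s z) = s (boxHomeomorph hev hσ _ z) := by
  obtain ⟨a, t, rfl⟩ := exists_box_eq hev z
  have h1 : (s (box (theta hσ) a (ev t)) : Box (theta hσ)) = box _ (s a) (ev 1) := by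
    rw [ev_one]; rfl
  rw [h1, boxHomeomorph_box, boxHomeomorph_box,
    s_mul _ _ (by rw [hσ.s_apply, N.r_fib]), N.s_fib]
  change σ (N.toQ (s a)) * (N.sX (N.toQ (s a))).1 = _
  rw [toQ_s, hσ.unital _ (N.sX _).2, sX_unit]
  exact r_mul_of_eq (N.sX (N.toQ a)).2.symm

theorem boxHomeomorph_mul (z w : Box (theta hσ)) (e : s z = r w) :
    boxHomeomorph hev hσ _ (z * w) = boxHomeomorph hev hσ _ z * boxHomeomorph hev hσ _ w := by
  obtain ⟨a, t, rfl⟩ := exists_box_eq hev z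
  obtain ⟨b, u, rfl⟩ := exists_box_eq hev w
  have hHT := N.isTopologicalGroupoid_HT hσ
  have eab : s a = r b := congrArg (fun z : Box (theta hσ) => z.1.1) e
  have ex := N.comp_toQ eab
  obtain ⟨t', h1, h2⟩ := N.exists_diaInv_ev b (reb ex t) (hσ.cls_apply (N.toQ b))
  rw [box_mul _ _ eab, reb_ev, h1, theta, ← ev_mul, ← ev_mul, reb_ev, boxHomeomorph_box,
    boxHomeomorph_box, boxHomeomorph_box]
  change σ (N.toQ (a * b)) * ((σ (N.toQ a * N.toQ b))⁻¹ * σ (N.toQ a) * σ (N.toQ b) * t'.1.1 *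
    u.1.1) = _
  rw [h2, N.toQ_mul eab]
  refine section_mul_identity ?_ ?_ ?_ ?_ ?_
  · rw [hσ.s_apply, hσ.r_apply, ex]
  · rw [hσ.r_apply, hσ.r_apply, N.rX_mul ex]
  · rw [N.r_fib, hσ.r_apply]
  · rw [N.s_fib, hσ.r_apply]
  · rw [N.r_fib, hσ.s_apply]

theorem boxHomeomorph_inv (z : Box (theta hσ)) :
    boxHomeomorph hev hσ _ z⁻¹ = (boxHomeomorph hev hσ _ z)⁻¹ := by
  obtain ⟨a, t, rfl⟩ := exists_box_eq hev z
  have hQ := N.isGroupoid_Q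
  have ex : N.rX (N.toQ a) = N.sX (N.toQ a⁻¹) := by rw [toQ_inv, sX_inv]
  have e1 : (box (theta hσ) a (ev t))⁻¹ = box (theta hσ) a⁻¹ ((theta hσ a a⁻¹ (N.s_eq_r_inv _))⁻¹ *
      reb ex (N.dia a (ev t)⁻¹)) := rfl
  obtain ⟨t', h1, h2⟩ := N.exists_dia_ev a t⁻¹ (hσ.cls_apply (N.toQ a))
  rw [e1, ← ev_inv, h1, theta, ← ev_inv, reb_ev, ← ev_mul, boxHomeomorph_box, boxHomeomorph_box]
  change σ (N.toQ a⁻¹) * (((σ (N.toQ a * N.toQ a⁻¹))⁻¹ * σ (N.toQ a) * σ (N.toQ a⁻¹))⁻¹ *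
    t'.1.1) = _
  have h3 : σ (N.toQ a * N.toQ a⁻¹) = r (σ (N.toQ a)) := by
    rw [toQ_inv, hQ.mul_inv_self, hσ.r_apply]
    exact hσ.unital _ (N.rX _).2
  rw [h2, h3, inv_r, r_mul_self]
  change _ * (_ * (_ * t.1.1⁻¹ * _)) = _
  have h4 : r (σ (N.toQ a⁻¹)) = (N.sX (N.toQ a)).1 := by rw [hσ.r_apply, toQ_inv, rX_inv]
  exact section_inv_identity (by rw [hσ.s_apply, h4]) (by rw [N.r_fib, h4]) (by rw [N.s_fib, h4])

theorem isTopGroupoidIso_boxHomeomorph : IsTopGroupoidIso (boxHomeomorph hev hσ (theta hσ)) :=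
  isTopGroupoidIso_of_homeomorph _ (boxHomeomorph_r hev hσ) (boxHomeomorph_s hev hσ)
    (boxHomeomorph_mul hev hσ)

include hev in
theorem isTopologicalGroupoid_box : IsTopologicalGroupoid (Box (theta hσ)) :=
  .of_homeomorph (boxHomeomorph hev hσ (theta hσ)) (boxHomeomorph_r hev hσ)
    (boxHomeomorph_s hev hσ) (boxHomeomorph_inv hev hσ) (boxHomeomorph_mul hev hσ)

end HT

end NormalAbelianSubgroupoid

theorem mainTheorem5 {G : Type u} [TopologicalSpace G] [T2Space G] [LocallyCompactSpace G]
    [GroupoidOps G] [IsEtaleGroupoid G] {Γ : Type v} [AddCommGroup Γ] [TopologicalSpace Γ]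
    [DiscreteTopology Γ] (c : G → Γ) (S : Set G) (hS : IsDynamicalCartan c S)
    (σ : hS.toNormal.Q → G) (hσ : hS.toNormal.IsUnitalSection σ) :
    -- `H` is a topological groupoid, and so is `H/T`, with the operations induced from `H`
    IsTopologicalGroupoid hS.toNormal.H ∧
    IsTopologicalGroupoid hS.toNormal.HT ∧
    IsGroupoidHom hS.toNormal.cl ∧
    -- the canonical identifications `H/T ≅ G/S` and `S ≅ T̂`
    (∃ e : hS.toNormal.HT ≃ₜ hS.toNormal.Q,
      IsTopGroupoidIso e ∧ ∀ a, e a = hS.toNormal.toQ a) ∧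
    IsHomeomorph (AbGroupBundle.evE : hS.toNormal.bundle.E → hS.toNormal.That.E) ∧
    (∀ (x : Obj G) (a b : hS.toNormal.bundle.Fib x),
      AbGroupBundle.ev (a * b) = AbGroupBundle.ev a * AbGroupBundle.ev b) ∧
    -- `θ` is a twisting cocycle, so that `H/T ⊠_θ T̂` is a topological groupoid
    hS.toNormal.IsTwistingCocycle (NormalAbelianSubgroupoid.theta hσ) ∧
    IsTopologicalGroupoid (NormalAbelianSubgroupoid.Box (NormalAbelianSubgroupoid.theta hσ)) ∧
    -- `([g], t) ↦ 𝔰([g]) t` is an isomorphism, and `c` induces a compatible cocycle on `H`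
    ∃ Φ : NormalAbelianSubgroupoid.Box (NormalAbelianSubgroupoid.theta hσ) ≃ₜ G,
      IsTopGroupoidIso Φ ∧
      (∀ (a : hS.toNormal.HT) (t : hS.toNormal.bundle.Fib (hS.toNormal.sX (hS.toNormal.toQ a))),
        Φ (NormalAbelianSubgroupoid.box (NormalAbelianSubgroupoid.theta hσ) a
          (AbGroupBundle.ev t)) = σ (hS.toNormal.toQ a) * t.1.1) ∧
      ∃ cbar : hS.toNormal.H → Γ,
        IsCocycle cbar ∧
        (∀ (g : G) (x : hS.toNormal.T.Fib (hS.toNormal.sX (hS.toNormal.cls g))),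
          cbar (hS.toNormal.arrow (hS.toNormal.cls g) x) = c g) ∧
        (∀ (h : hS.toNormal.H)
          (χ : hS.toNormal.That.Fib (hS.toNormal.sX (hS.toNormal.toQ (hS.toNormal.cl h)))),
          c (Φ (NormalAbelianSubgroupoid.box (NormalAbelianSubgroupoid.theta hσ)
            (hS.toNormal.cl h) χ)) = cbar h) := by
  have hπ := hS.toNormal.isLocalHomeomorph_bundle hS.isOpen
  have := hS.toNormal.locallyCompactSpace_bundle hS.isClosed
  have := NormalAbelianSubgroupoid.locallyCompactSpace_obj (G := G)
  have hev := AbGroupBundle.isHomeomorph_evE hπ hS.toNormal.continuousOn_mulE_bundle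
  have hc : ∀ a ∈ hS.toNormal.carrier, c a = 0 := fun a ha => (hS.subset_isoKer ha).2
  refine ⟨hS.toNormal.isTopologicalGroupoid_H hS.isClosed hσ,
    hS.toNormal.isTopologicalGroupoid_HT hσ, hS.toNormal.isGroupoidHom_cl,
    ⟨_, hS.toNormal.isTopGroupoidIso_homeomorphQ, fun _ => rfl⟩, hev,
    fun _ => AbGroupBundle.ev_mul,
    NormalAbelianSubgroupoid.isTwistingCocycle_theta hS.isClosed hσ,
    NormalAbelianSubgroupoid.isTopologicalGroupoid_box hev hσ,
    NormalAbelianSubgroupoid.boxHomeomorph hev hσ _,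
    NormalAbelianSubgroupoid.isTopGroupoidIso_boxHomeomorph hev hσ,
    NormalAbelianSubgroupoid.boxHomeomorph_box hev hσ _,
    fun h => c (σ h.1.1), hS.toNormal.isCocycle_H hS.cocycle hc hσ, fun g x => ?_, fun h χ => ?_⟩
  · exact hS.toNormal.apply_eq_of_cls_eq hS.cocycle hc (hσ.cls_apply _)
  · obtain ⟨t, rfl⟩ := AbGroupBundle.ev_surjective hπ χ
    rw [NormalAbelianSubgroupoid.boxHomeomorph_box, hS.cocycle.map_mul _ _ (by
      rw [hσ.s_apply, hS.toNormal.r_fib]), hc _ t.1.2, add_zero]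
    rfl
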